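/- **Setting.** Let $S^1=\mathbb R/\mathbb Z$, and for $x,y\in S^1$ let $\vec d(x,y)\in[0,1)$ be the clockwise distance from $x$ to $y$, i.e. the representative of $y-x$ in $[0,1)$. For $X\subseteq S^1$ finite and $0<r\le 1$, the map $f_r\colon X\to X$ sends $x$ to the point $y\in X$ that maximizes $\vec d(x,y)$ among the $y\in X$ with $\vec d(x,y)<r$. A point $x\in X$ is *periodic* if $f_r^k(x)=x$ for some $k\ge1$. The *winding number* of $x_0,\dots,x_s\in S^1$ is $\mathrm{wn}(x_0,\dots,x_s)=\sum_{k=0}^{s-1}\vec d(x_k,x_{k+1})+\vec d(x_s,x_0)$. Let $p,q$ be relatively prime integers with $0<p\le q$, and put $r=p/q$. For $i\ge 0$, a point $x\in X$ is *$(q,i)$-swift* if $\mathrm{wn}(x,f_r(x),\dots,f_r^q(x))=p$ and $x$ is the first point of $X$ clockwise after the set $A=f_r^{-i}(f_r^{q+i}(x))$; that is, $x\notin A$ and there is $a\in A$ such that the open clockwise arc from $a$ to $x$ contains no point of $X$. A periodic point $x_0$ is *of swiftness type $i$* if $i$ is the smallest index $j\ge 0$ such that $x_0=f_r^{q+j}(y)$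 for some $(q,j)$-swift point $y\in X$. Let $\mathrm{swi}_i(X,\tfrac pq)$ be the number of periodic points of swiftness type $i$. *Gaps.* For $x_0\in X$, let $y_0$ be the nearest point of $X$ clockwise strictly after $x_0$, and inductively let $x_j$ (resp. $y_j$) be the nearest point of $X$ clockwise strictly after $x_{j-1}-r$ (resp. $y_{j-1}-r$). (If $X$ has no point other than $a$, the nearest point strictly after $a$ is taken to be $a$.) Put $z_1=\vec d(x_0,y_0)$ and, for $j\ge1$, $w_j=\vec d(x_{j-1}-r,x_j)$, $z_{j+1}=\vec d(y_{j-1}-r,y_j)$. *Cone.* Let $m=i+q-1$. For $u=(z_1,\dots,z_m,w_1,\dots,w_m)\in\mathbb R^{2m}$ let $H(j,k)$ be the inequality $z_1+\dots+z_j\ge w_1+\dots+w_k$, where variables with an index exceeding $m$ are omitted and an empty sum is $0$. (Omission occurs only when $q=1$.) Let $S_i(q)$ be the set of all $u$ with nonnegative entries such that $H(j,j)$ holds for $1\le j\le i+q-1$, $H(j,j+q-2)$ fails for $1\le j\le i$, and $H(i+1,i+q-1)$ holds. **Proposition.** Let $X_n$ be a set of $n$ points chosen uniformly and independently from $S^1$,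 let $p,q$ be relatively prime with $0<p\le q$, let $r=p/q$, and let $i\ge0$. Then $\mathrm{swi}_i(X_n,\tfrac pq)$ is an integrable random variable, the integral on the right is finite, and the limiting expected fraction of periodic points of swiftness type $i$ is $$sw_i(p/q):=\lim_{n\to\infty}\frac{\mathbf E[\mathrm{swi}_i(X_n,\tfrac pq)]}{n}=\lim_{n\to\infty}\mathbf P[u\in S_i(q)]=\int_{S_i(q)}e^{-\|u\|_1}\,du,$$ where both limits exist and, in the second one, $\{u\in S_i(q)\}$ is measurable up to a null set and $u=(z_1,\dots,z_{i+q-1},w_1,\dots,w_{i+q-1})$ is the vector of gaps of $X_n$ seen from one of the sample points $x_0\in X_n$, whose index in the sample may be chosen arbitrarily for each $n$. -/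

import Mathlib

open MeasureTheory Filter Topology

noncomputable section

namespace CyclicDyn

/-- The circle `S¹ = ℝ / ℤ` of unit circumference; the clockwise direction is the one in which
the real coordinate increases. -/
abbrev Circ : Type := UnitAddCircle

/-- The clockwise distance from `x` to `y`: the representative in `[0, 1)` of `y - x`. -/
def cdist (x y : Circ) : ℝ := ((AddCircle.equivIco (1 : ℝ) 0 (y - x) : Set.Ico (0 : ℝ) (0 + 1)) : ℝ)

/-- The open clockwise arc from `x` to `y`. -/
def openArc (x y : Circ) : Set Circ := {t | 0 < cdist x t ∧ cdist x t < cdist x y}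

/-- `y` is a point of `X ∩ [x, x + r)` which is clockwise furthest from `x`. -/
def IsFurthest (X : Set Circ) (r : ℝ) (x y : Circ) : Prop :=
  y ∈ X ∧ cdist x y < r ∧ ∀ t ∈ X, cdist x t < r → cdist x t ≤ cdist x y

open Classical in
/-- The map `f_r : X → X` which sends `x` to the clockwise furthest point of `X ∩ [x, x + r)`,
as a map of the circle that preserves `X` (see `step_mem`). -/
def step (X : Set Circ) (r : ℝ) (x : Circ) : Circ :=
  if h : ∃ y, IsFurthest X r x y then h.choose else x

/-- `y` is a point of `X` which is clockwise nearest to `a` among the points strictly after `a`. -/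
def IsNext (X : Set Circ) (a y : Circ) : Prop :=
  y ∈ X ∧ y ≠ a ∧ ∀ t ∈ X, t ≠ a → cdist a y ≤ cdist a t

open Classical in
/-- The clockwise nearest point of `X` strictly after `a` (and `a` if `X` has no point other
than `a`). -/
def next (X : Set Circ) (a : Circ) : Circ :=
  if h : ∃ y, IsNext X a y then h.choose else a

/-- The winding number of the closed walk `x 0 → x 1 → ⋯ → x s → x 0`. -/
def wind (s : ℕ) (x : ℕ → Circ) : ℝ :=
  (∑ k ∈ Finset.range s, cdist (x k) (x (k + 1))) + cdist (x s) (x 0)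

/-- The preimage set `f_r^{-i}(a) ⊆ X`. -/
def preim (X : Set Circ) (r : ℝ) (i : ℕ) (a : Circ) : Set Circ :=
  {y ∈ X | (step X r)^[i] y = a}

/-- `x` is the first point of `X` clockwise after the subset `A` of `X`: it is not in `A`, and
it comes immediately after some point of `A`. -/
def IsFirstAfter (X A : Set Circ) (x : Circ) : Prop :=
  x ∈ X ∧ x ∉ A ∧ ∃ a ∈ A, ∀ t ∈ X, t ∉ openArc a x

/-- For `r = p / q`, the point `x` of `X` is `(q, i)`-swift. -/
def IsSwift (X : Set Circ) (p q i : ℕ) (x : Circ) : Prop :=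
  x ∈ X ∧
  wind q (fun k => (step X ((p : ℝ) / q))^[k] x) = p ∧
  IsFirstAfter X (preim X ((p : ℝ) / q) i ((step X ((p : ℝ) / q))^[q + i] x)) x

/-- The point `x` of `X` is periodic for `f_r`. -/
def IsPeriodic (X : Set Circ) (r : ℝ) (x : Circ) : Prop :=
  x ∈ X ∧ ∃ k : ℕ, 1 ≤ k ∧ (step X r)^[k] x = x

/-- For `r = p / q`, the point `x` is a periodic point of swiftness type `i`: the index `i` is the
smallest one such that `x = f_r^{q+i}(y)` for some `(q, i)`-swift point `y`. -/
def IsOfType (X : Set Circ) (p q i : ℕ) (x : Circ) : Prop :=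
  IsPeriodic X ((p : ℝ) / q) x ∧
  IsLeast {j : ℕ | ∃ y, IsSwift X p q j y ∧ (step X ((p : ℝ) / q))^[q + j] y = x} i

/-- The number of periodic points of `f_{p/q} : X → X` of swiftness type `i`. -/
def swi (X : Set Circ) (p q i : ℕ) : ℕ := {x | IsOfType X p q i x}.ncard

/-- The sequence starting at `a` in which every term is the clockwise nearest point of `X` strictly
after (previous term) `- r`. -/
def back (X : Set Circ) (r : ℝ) (a : Circ) : ℕ → Circ
  | 0 => a
  | j + 1 => next X (back X r a j - (r : Circ))

/-- The sequence `x_0, x_1, …`. -/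
def xs (X : Set Circ) (r : ℝ) (x₀ : Circ) : ℕ → Circ := back X r x₀

/-- The sequence `y_0, y_1, …`, where `y_0` is the clockwise nearest neighbour of `x_0`. -/
def ys (X : Set Circ) (r : ℝ) (x₀ : Circ) : ℕ → Circ := back X r (next X x₀)

/-- The gaps `z_1, z_2, …`, numbered from `0`: `zgap 0 = d(x_0, y_0)` is `z_1`, and
`zgap (j + 1) = d(y_j - r, y_{j+1})` is `z_{j+2}`. -/
def zgap (X : Set Circ) (r : ℝ) (x₀ : Circ) : ℕ → ℝ
  | 0 => cdist x₀ (ys X r x₀ 0)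
  | j + 1 => cdist (ys X r x₀ j - (r : Circ)) (ys X r x₀ (j + 1))

/-- The gaps `w_1, w_2, …`, numbered from `0`: `wgap j = d(x_j - r, x_{j+1})` is `w_{j+1}`. -/
def wgap (X : Set Circ) (r : ℝ) (x₀ : Circ) (j : ℕ) : ℝ :=
  cdist (xs X r x₀ j - (r : Circ)) (xs X r x₀ (j + 1))

/-- The space of vectors `u = (z_1, …, z_m, w_1, …, w_m)`. -/
abbrev GapSpace (m : ℕ) : Type := (Fin m → ℝ) × (Fin m → ℝ)

/-- The vector `u = (z_1, …, z_m, w_1, …, w_m)` of gaps of `X` seen from `x_0`. -/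
def gaps (m : ℕ) (X : Set Circ) (r : ℝ) (x₀ : Circ) : GapSpace m :=
  (fun l => zgap X r x₀ l, fun l => wgap X r x₀ l)

/-- The inequality `H(j, k)`: `z_1 + ⋯ + z_j ≥ w_1 + ⋯ + w_k`. -/
def H {m : ℕ} (j k : ℕ) (u : GapSpace m) : Prop :=
  ∑ l : Fin m with l.val < k, u.2 l ≤ ∑ l : Fin m with l.val < j, u.1 l

/-- The `ℓ¹` norm `‖u‖₁`. -/
def norm1 {m : ℕ} (u : GapSpace m) : ℝ := ∑ l, |u.1 l| + ∑ l, |u.2 l|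

/-- The cone `S_i(q)` in `ℝ₊^{2i+2q-2}`, given by
`H(1,1), …, H(i+q-1,i+q-1)`, `¬H(1,q-1), ¬H(2,q), …, ¬H(i,i+q-2)` and `H(i+1,i+q-1)`. -/
def S (q i : ℕ) : Set (GapSpace (i + q - 1)) :=
  {u | (∀ l, 0 ≤ u.1 l) ∧ (∀ l, 0 ≤ u.2 l) ∧
    (∀ j, 1 ≤ j → j ≤ i + q - 1 → H j j u) ∧
    (∀ j, 1 ≤ j → j ≤ i → ¬ H j (j + q - 2) u) ∧
    H (i + 1) (i + q - 1) u}

/-- The law of `n` independent uniform points of the circle. -/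
def sampleLaw (n : ℕ) : Measure (Fin n → Circ) := Measure.pi fun _ => (volume : Measure Circ)

theorem cdist_self (x : Circ) : cdist x x = 0 := by
  have h : AddCircle.equivIco (1 : ℝ) 0 ((0 : ℝ) : Circ) = ⟨0, by norm_num⟩ := by
    rw [← Equiv.eq_symm_apply]; rfl
  have h0 : ((0 : ℝ) : Circ) = 0 := rfl
  rw [h0] at h
  simp [cdist, h]

/-- The clockwise furthest point exists. -/
theorem exists_isFurthest {X : Set Circ} (hX : X.Finite) {r : ℝ} (hr : 0 < r) {x : Circ}
    (hx : x ∈ X) : ∃ y, IsFurthest X r x y := by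
  obtain ⟨y, ⟨hy, hyr⟩, hmax⟩ := Set.exists_max_image {t ∈ X | cdist x t < r} (cdist x)
    (hX.subset (Set.sep_subset _ _)) ⟨x, hx, by simpa [cdist_self] using hr⟩
  exact ⟨y, hy, hyr, fun t ht htr => hmax t ⟨ht, htr⟩⟩

theorem step_spec {X : Set Circ} (hX : X.Finite) {r : ℝ} (hr : 0 < r) {x : Circ}
    (hx : x ∈ X) : IsFurthest X r x (step X r x) := by
  have h := exists_isFurthest hX hr hx
  rw [step, dif_pos h]
  exact h.choose_spec

theorem step_mem {X : Set Circ} (hX : X.Finite) {r : ℝ} (hr : 0 < r) {x : Circ}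
    (hx : x ∈ X) : step X r x ∈ X :=
  (step_spec hX hr hx).1

theorem isProbabilityMeasure_sampleLaw (n : ℕ) : IsProbabilityMeasure (sampleLaw n) := by
  haveI : IsProbabilityMeasure (volume : Measure Circ) := ⟨UnitAddCircle.measure_univ⟩
  unfold sampleLaw
  infer_instance

end CyclicDyn

end

noncomputable section

namespace CyclicDyn

/-! ### The clockwise distance -/

/-! Deterministic half. Lift `X` to a periodic subset of the line; let `F` be the lifted step, `N`
the lifted successor and `B t = N (t - r)`. On lifted points `F` is monotone and adjoint to `B`: `B
t ≤ s ↔ t ≤ F s`. Hence the points that `F^j` sends to `t` are those of the interval `[B^j t, B^j (N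
t))`. When `X` has no long gap, the winding condition is automatic, and the only candidate for a
`(q, j)`-swift point over `t` is `B^j (N t)`; it works exactly when `B^j t < B^j (N t)` and `B^(q+j)
t ≤ B^j (N t) - p` (`exists_swift_iff`). These two inequalities already force `t` to be periodic
(`isPeriodic_of_swift`). Partial sums of gaps telescope to iterates of `B`, so for generic `X` the
inequalities turn into those of the cone (`isOfType_iff`).

Probabilistic half. Fix `x₀`, let `m = i + q - 1`, and guess which `2m` of the other `N` sample
points are `y_0, …, y_{m-1}, x_1, …, x_m`. The passage from such a tuple to its gaps carries
Lebesgue measure to Lebesgue measure on the unit box (`measurePreserving_tupleGaps`). The guess is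
right when no other sample point lies in the arcs spanned by the gaps. The inequalities of the cone
make these arcs pairwise disjoint once `‖u‖₁ < 1/q` (`gapArc_disjoint`), so their total length is
`‖u‖₁` and the remaining points avoid them with probability `(1 - ‖u‖₁)^(N - 2m)`. Summing over the
guesses gives an exact formula (`measure_gaps_mem_smallCone`); the substitution `u = v / N` and
dominated convergence give the integral (`tendsto_smallProb`).

Samples with a long gap have probability tending to zero, so neither the restriction to short gaps
nor the use of fineness affects the limit. The expected count is a sum over sample indices, and the
error bound is the same for every index. -/

instance isProbabilityMeasure_circ : IsProbabilityMeasure (volume : Measure Circ) :=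
  ⟨UnitAddCircle.measure_univ⟩

instance isProbabilityMeasure_sampleLaw' (n : ℕ) : IsProbabilityMeasure (sampleLaw n) :=
  isProbabilityMeasure_sampleLaw n

theorem cdist_coe (a b : ℝ) : cdist (a : Circ) b = Int.fract (b - a) := by
  have := AddCircle.coe_equivIco_mk_apply (1 : ℝ) (b - a)
  simp only [div_one, mul_one] at this
  rw [← this]; rfl

theorem coe_eq_coe_iff {a b : ℝ} : (a : Circ) = b ↔ ∃ n : ℤ, b = a + n := by
  rw [eq_comm, ← sub_eq_zero, ← AddCircle.coe_sub, AddCircle.coe_eq_zero_iff]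
  constructor
  · rintro ⟨n, hn⟩; refine ⟨n, ?_⟩; simp at hn; linarith
  · rintro ⟨n, hn⟩; exact ⟨n, by simp; linarith⟩

theorem coe_surj (x : Circ) : ∃ a : ℝ, (a : Circ) = x := QuotientAddGroup.mk_surjective x

theorem coe_add_int (a : ℝ) (n : ℤ) : ((a + n : ℝ) : Circ) = a :=
  (coe_eq_coe_iff.2 ⟨n, rfl⟩).symm

theorem cdist_nonneg (x y : Circ) : 0 ≤ cdist x y := by
  obtain ⟨a, rfl⟩ := coe_surj x
  obtain ⟨b, rfl⟩ := coe_surj y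
  rw [cdist_coe]; exact Int.fract_nonneg _

theorem cdist_lt_one (x y : Circ) : cdist x y < 1 := by
  obtain ⟨a, rfl⟩ := coe_surj x
  obtain ⟨b, rfl⟩ := coe_surj y
  rw [cdist_coe]; exact Int.fract_lt_one _

theorem coe_cdist (x y : Circ) : ((cdist x y : ℝ) : Circ) = y - x := by
  obtain ⟨a, rfl⟩ := coe_surj x
  obtain ⟨b, rfl⟩ := coe_surj y
  rw [cdist_coe, ← AddCircle.coe_sub, coe_eq_coe_iff]
  exact ⟨⌊b - a⌋, (Int.fract_add_floor _).symm⟩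

theorem add_coe_cdist (x y : Circ) : x + ((cdist x y : ℝ) : Circ) = y := by
  rw [coe_cdist]; abel

theorem cdist_coe_of_le {a b : ℝ} (h : a ≤ b) (h' : b < a + 1) : cdist (a : Circ) b = b - a := by
  rw [cdist_coe, Int.fract_eq_self]; constructor <;> linarith

theorem cdist_eq_of_add {x y : Circ} {c : ℝ} (h0 : 0 ≤ c) (h1 : c < 1) (h : y = x + (c : Circ)) :
    cdist x y = c := by
  obtain ⟨a, rfl⟩ := coe_surj x
  subst h
  rw [← AddCircle.coe_add, cdist_coe_of_le] <;> linarith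

theorem cdist_inj {x y z : Circ} (h : cdist x y = cdist x z) : y = z := by
  rw [← add_coe_cdist x y, h, add_coe_cdist]

theorem cdist_pos_iff {x y : Circ} : 0 < cdist x y ↔ y ≠ x := by
  constructor
  · rintro h rfl; rw [cdist_self] at h; exact lt_irrefl _ h
  · intro h
    refine lt_of_le_of_ne (cdist_nonneg _ _) fun h0 => h ?_
    rw [← add_coe_cdist x y, ← h0]; simp

theorem cdist_eq_cdist_zero (x y : Circ) : cdist x y = cdist 0 (y - x) := by
  simp [cdist]

theorem measurable_cdist_zero : Measurable (cdist 0) := by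
  have : cdist 0 = fun y => ((AddCircle.measurableEquivIco (1 : ℝ) 0 y : Set.Ico (0 : ℝ) (0 + 1)) : ℝ) := by
    ext y; simp only [cdist, sub_zero]; rfl
  rw [this]
  exact measurable_subtype_coe.comp (AddCircle.measurableEquivIco (1 : ℝ) 0).measurable

theorem measurable_cdist {α : Type*} [MeasurableSpace α] {f g : α → Circ} (hf : Measurable f)
    (hg : Measurable g) : Measurable fun a => cdist (f a) (g a) := by
  have : (fun a => cdist (f a) (g a)) = fun a => cdist 0 (g a - f a) :=
    funext fun a => cdist_eq_cdist_zero _ _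
  rw [this]
  exact measurable_cdist_zero.comp (hg.sub hf)

theorem measurePreserving_cdist_zero :
    MeasurePreserving (cdist 0) volume ((volume : Measure ℝ).restrict (Set.Ico 0 1)) := by
  refine ⟨measurable_cdist_zero, ?_⟩
  have h := UnitAddCircle.measurePreserving_mk 0
  rw [zero_add, Measure.restrict_congr_set (Ico_ae_eq_Ioc (a := (0 : ℝ)) (b := 1)).symm] at h
  rw [← h.map_eq, Measure.map_map measurable_cdist_zero h.measurable]
  have : (cdist 0 ∘ QuotientAddGroup.mk) =ᵐ[(volume : Measure ℝ).restrict (Set.Ico 0 1)] id := by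
    filter_upwards [ae_restrict_mem measurableSet_Ico] with a ha
    have := cdist_coe_of_le (a := 0) (b := a) ha.1 (by simpa using ha.2)
    simpa using this
  rw [Measure.map_congr this, Measure.map_id]

theorem measurePreserving_cdist (x : Circ) :
    MeasurePreserving (cdist x) volume ((volume : Measure ℝ).restrict (Set.Ico 0 1)) := by
  have : cdist x = cdist 0 ∘ fun y => y - x := by ext y; exact cdist_eq_cdist_zero x y
  rw [this]
  exact measurePreserving_cdist_zero.comp (measurePreserving_sub_right volume x)

theorem volume_singleton_circ (x : Circ) : (volume : Measure Circ) {x} = 0 := by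
  have h := (measurePreserving_cdist x).measure_preimage (s := {0})
    (measurableSet_singleton _).nullMeasurableSet
  have h2 : cdist x ⁻¹' {0} = {x} := by
    ext y
    simp only [Set.mem_preimage, Set.mem_singleton_iff]
    constructor
    · intro h; rw [← add_coe_cdist x y, h]; simp
    · rintro rfl; exact cdist_self _
  rw [h2] at h
  rw [h]
  exact le_antisymm ((Measure.restrict_apply_le _ _).trans (by simp)) bot_le

/-! ### Lifting the dynamics to the real line -/

/-- The preimage of `X` in the real line. -/
def liftSet (X : Set Circ) : Set ℝ := {t | (t : Circ) ∈ X}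

/-- The lift of `step X r` to the real line. -/
def liftStep (X : Set Circ) (r t : ℝ) : ℝ := t + cdist t (step X r t)

/-- The lift of `next X` to the real line. -/
def liftNext (X : Set Circ) (a : ℝ) : ℝ := a + cdist a (next X a)

/-- The lift of one step of `back X r` to the real line. -/
def liftBack (X : Set Circ) (r t : ℝ) : ℝ := liftNext X (t - r)

/-- Every arc of length `η` meets `X`. -/
def IsFine (X : Set Circ) (η : ℝ) : Prop := ∀ a, ∃ t ∈ X, 0 < cdist a t ∧ cdist a t < η

theorem exists_isNext {X : Set Circ} (hX : X.Finite) {a : Circ} (h : ∃ t ∈ X, t ≠ a) :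
    ∃ y, IsNext X a y := by
  obtain ⟨t, ht, hta⟩ := h
  obtain ⟨y, ⟨hy, hya⟩, hmin⟩ := Set.exists_min_image {t ∈ X | t ≠ a} (cdist a)
    (hX.subset (Set.sep_subset _ _)) ⟨t, ht, hta⟩
  exact ⟨y, hy, hya, fun t ht hta => hmin t ⟨ht, hta⟩⟩

theorem next_spec {X : Set Circ} (hX : X.Finite) {a : Circ} (h : ∃ t ∈ X, t ≠ a) :
    IsNext X a (next X a) := by
  have h := exists_isNext hX h
  rw [next, dif_pos h]
  exact h.choose_spec

theorem IsNext.unique {X : Set Circ} {a y z : Circ} (hy : IsNext X a y) (hz : IsNext X a z) :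
    y = z :=
  cdist_inj (le_antisymm (hy.2.2 z hz.1 hz.2.1) (hz.2.2 y hy.1 hy.2.1))

theorem IsNext.next_eq {X : Set Circ} {a y : Circ} (hy : IsNext X a y) : next X a = y := by
  have h : ∃ y, IsNext X a y := ⟨y, hy⟩
  rw [next, dif_pos h]
  exact h.choose_spec.unique hy

section

variable {X : Set Circ}

theorem coe_liftStep (r t : ℝ) : ((liftStep X r t : ℝ) : Circ) = step X r t := by
  rw [liftStep, AddCircle.coe_add, add_coe_cdist]

theorem coe_liftNext (a : ℝ) : ((liftNext X a : ℝ) : Circ) = next X a := by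
  rw [liftNext, AddCircle.coe_add, add_coe_cdist]

theorem coe_iterate_liftStep (r t : ℝ) (k : ℕ) :
    (((liftStep X r)^[k] t : ℝ) : Circ) = (step X r)^[k] t := by
  induction k with
  | zero => rfl
  | succ k ih => rw [Function.iterate_succ_apply', Function.iterate_succ_apply', coe_liftStep, ih]

theorem liftStep_add_int (r t : ℝ) (n : ℤ) : liftStep X r (t + n) = liftStep X r t + n := by
  simp only [liftStep, coe_add_int]; ring

theorem iterate_liftStep_add_int (r t : ℝ) (n : ℤ) (k : ℕ) :
    (liftStep X r)^[k] (t + n) = (liftStep X r)^[k] t + n := by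
  induction k with
  | zero => rfl
  | succ k ih =>
    rw [Function.iterate_succ_apply', Function.iterate_succ_apply', ih, liftStep_add_int]

theorem le_liftStep (r t : ℝ) : t ≤ liftStep X r t := by
  have := cdist_nonneg t (step X r t)
  rw [liftStep]; linarith

theorem liftSet_add_int {t : ℝ} (n : ℤ) (ht : t ∈ liftSet X) : t + n ∈ liftSet X := by
  show ((t + n : ℝ) : Circ) ∈ X
  rw [coe_add_int]; exact ht

theorem liftStep_mem (hX : X.Finite) {r : ℝ} (hr : 0 < r) {t : ℝ} (ht : t ∈ liftSet X) :
    liftStep X r t ∈ liftSet X := by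
  show ((liftStep X r t : ℝ) : Circ) ∈ X
  rw [coe_liftStep]; exact step_mem hX hr ht

theorem liftStep_lt (hX : X.Finite) {r : ℝ} (hr : 0 < r) {t : ℝ} (ht : t ∈ liftSet X) :
    liftStep X r t < t + r := by
  have := (step_spec hX hr ht).2.1
  rw [liftStep]; linarith

/-- Maximality of the furthest point, on the line. The bound `r ≤ 1` ensures that a lifted point of
`[t, t + r)` is less than one turn away, so that its clockwise distance from `t` is the plain
difference. -/
theorem le_liftStep_of_lt (hX : X.Finite) {r : ℝ} (hr : 0 < r) (hr1 : r ≤ 1) {t s : ℝ}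
    (ht : t ∈ liftSet X) (hs : s ∈ liftSet X) (hst : s < t + r) : s ≤ liftStep X r t := by
  rcases lt_or_ge s t with h | h
  · exact h.le.trans (le_liftStep r t)
  · have e := cdist_coe_of_le h (by linarith)
    have := (step_spec hX hr ht).2.2 s hs (by rw [e]; linarith)
    rw [liftStep]; linarith

theorem iterate_liftStep_mem (hX : X.Finite) {r : ℝ} (hr : 0 < r) {t : ℝ} (ht : t ∈ liftSet X)
    (k : ℕ) : (liftStep X r)^[k] t ∈ liftSet X := by
  induction k with
  | zero => exact ht
  | succ k ih => rw [Function.iterate_succ_apply']; exact liftStep_mem hX hr ih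

theorem iterate_liftStep_le (hX : X.Finite) {r : ℝ} (hr : 0 < r) {t : ℝ} (ht : t ∈ liftSet X)
    (k : ℕ) : (liftStep X r)^[k] t ≤ t + k * r := by
  induction k with
  | zero => simp
  | succ k ih =>
    rw [Function.iterate_succ_apply']
    have := liftStep_lt hX hr (iterate_liftStep_mem hX hr ht k)
    push_cast; linarith

theorem iterate_liftStep_lt (hX : X.Finite) {r : ℝ} (hr : 0 < r) {t : ℝ} (ht : t ∈ liftSet X)
    {k : ℕ} (hk : 0 < k) : (liftStep X r)^[k] t < t + k * r := by
  obtain ⟨k, rfl⟩ := Nat.exists_eq_succ_of_ne_zero hk.ne'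
  rw [Function.iterate_succ_apply']
  have := liftStep_lt hX hr (iterate_liftStep_mem hX hr ht k)
  have := iterate_liftStep_le hX hr ht k
  push_cast; linarith

theorem liftStep_mono (hX : X.Finite) {r : ℝ} (hr : 0 < r) (hr1 : r ≤ 1) {t s : ℝ}
    (ht : t ∈ liftSet X) (hs : s ∈ liftSet X) (hts : t ≤ s) : liftStep X r t ≤ liftStep X r s :=
  le_liftStep_of_lt hX hr hr1 hs (liftStep_mem hX hr ht)
    ((liftStep_lt hX hr ht).trans_le (by linarith))

theorem iterate_liftStep_mono (hX : X.Finite) {r : ℝ} (hr : 0 < r) (hr1 : r ≤ 1) {t s : ℝ}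
    (ht : t ∈ liftSet X) (hs : s ∈ liftSet X) (hts : t ≤ s) (k : ℕ) :
    (liftStep X r)^[k] t ≤ (liftStep X r)^[k] s := by
  induction k with
  | zero => exact hts
  | succ k ih =>
    rw [Function.iterate_succ_apply', Function.iterate_succ_apply']
    exact liftStep_mono hX hr hr1 (iterate_liftStep_mem hX hr ht k)
      (iterate_liftStep_mem hX hr hs k) ih

variable {η : ℝ}

theorem IsFine.exists_ne (h : IsFine X η) (a : Circ) : ∃ t ∈ X, t ≠ a := by
  obtain ⟨t, ht, h0, -⟩ := h a
  exact ⟨t, ht, cdist_pos_iff.1 h0⟩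

theorem liftNext_mem (hX : X.Finite) (h : IsFine X η) (a : ℝ) : liftNext X a ∈ liftSet X := by
  show ((liftNext X a : ℝ) : Circ) ∈ X
  rw [coe_liftNext]; exact (next_spec hX (h.exists_ne _)).1

theorem lt_liftNext (hX : X.Finite) (h : IsFine X η) (a : ℝ) : a < liftNext X a := by
  have := cdist_pos_iff.2 (next_spec hX (h.exists_ne a)).2.1
  rw [liftNext]; linarith

theorem liftNext_lt (hX : X.Finite) (h : IsFine X η) (a : ℝ) : liftNext X a < a + η := by
  obtain ⟨t, ht, h0, h1⟩ := h a
  have := (next_spec hX (h.exists_ne a)).2.2 t ht (cdist_pos_iff.1 h0)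
  rw [liftNext]; linarith

theorem liftNext_le (hX : X.Finite) (h : IsFine X η) {a s : ℝ} (hs : s ∈ liftSet X) (has : a < s) :
    liftNext X a ≤ s := by
  rw [liftNext]
  rcases lt_or_ge s (a + 1) with h1 | h1
  · have e := cdist_coe_of_le has.le h1
    have := (next_spec hX (h.exists_ne a)).2.2 s hs (cdist_pos_iff.1 (by rw [e]; linarith))
    linarith
  · have := cdist_lt_one a (next X a)
    linarith

theorem lt_liftStep (hX : X.Finite) (h : IsFine X η) {r : ℝ} (hr : 0 < r) (hr1 : r ≤ 1) {t : ℝ}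
    (ht : t ∈ liftSet X) : t + r - η < liftStep X r t :=
  (lt_liftNext hX h _).trans_le (le_liftStep_of_lt hX hr hr1 ht (liftNext_mem hX h _)
    (by linarith [liftNext_lt hX h (t + r - η)]))

theorem le_iterate_liftStep (hX : X.Finite) (h : IsFine X η) {r : ℝ} (hr : 0 < r) (hr1 : r ≤ 1)
    {t : ℝ} (ht : t ∈ liftSet X) (k : ℕ) : t + k * r - k * η ≤ (liftStep X r)^[k] t := by
  induction k with
  | zero => simp
  | succ k ih =>
    rw [Function.iterate_succ_apply']
    have := lt_liftStep hX h hr hr1 (iterate_liftStep_mem hX hr ht k)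
    push_cast; linarith

/-- Adjunction between forward and backward steps: both sides say `t - r < s`, the left by
minimality of the successor of `t - r`, the right by maximality of the step from `s`. -/
theorem liftBack_le_iff (hX : X.Finite) (h : IsFine X η) {r : ℝ} (hr : 0 < r) (hr1 : r ≤ 1)
    {t s : ℝ} (ht : t ∈ liftSet X) (hs : s ∈ liftSet X) :
    liftBack X r t ≤ s ↔ t ≤ liftStep X r s := by
  constructor
  · intro h'
    have := lt_liftNext hX h (t - r)
    exact le_liftStep_of_lt hX hr hr1 hs ht (by rw [liftBack] at h'; linarith)
  · intro h'
    exact liftNext_le hX h hs (by linarith [liftStep_lt hX hr hs])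

theorem iterate_liftBack_mem (hX : X.Finite) (h : IsFine X η) {r : ℝ} {t : ℝ} (ht : t ∈ liftSet X)
    (k : ℕ) : (liftBack X r)^[k] t ∈ liftSet X := by
  cases k with
  | zero => exact ht
  | succ k => rw [Function.iterate_succ_apply']; exact liftNext_mem hX h _

theorem iterate_liftBack_le_iff (hX : X.Finite) (h : IsFine X η) {r : ℝ} (hr : 0 < r) (hr1 : r ≤ 1)
    {t s : ℝ} (ht : t ∈ liftSet X) (hs : s ∈ liftSet X) (k : ℕ) :
    (liftBack X r)^[k] t ≤ s ↔ t ≤ (liftStep X r)^[k] s := by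
  induction k generalizing t with
  | zero => rfl
  | succ k ih =>
    rw [Function.iterate_succ_apply, ih (t := liftBack X r t) (liftNext_mem hX h _),
      liftBack_le_iff hX h hr hr1 ht (iterate_liftStep_mem hX hr hs k),
      Function.iterate_succ_apply']

theorem le_iterate_liftBack (hX : X.Finite) (h : IsFine X η) {r : ℝ} (t : ℝ) (k : ℕ) :
    t - k * r ≤ (liftBack X r)^[k] t := by
  induction k with
  | zero => simp
  | succ k ih =>
    rw [Function.iterate_succ_apply']
    have := lt_liftNext hX h ((liftBack X r)^[k] t - r)
    rw [liftBack]
    push_cast; linarith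

theorem iterate_liftBack_le (hX : X.Finite) (h : IsFine X η) {r : ℝ} (t : ℝ) (k : ℕ) :
    (liftBack X r)^[k] t ≤ t - k * r + k * η := by
  induction k with
  | zero => simp
  | succ k ih =>
    rw [Function.iterate_succ_apply']
    have := liftNext_lt hX h ((liftBack X r)^[k] t - r)
    rw [liftBack]
    push_cast; linarith

/-- The set of lifted points that `k` steps carry to `t` is an interval of the lifted set. -/
theorem iterate_liftStep_eq_iff (hX : X.Finite) (h : IsFine X η) {r : ℝ} (hr : 0 < r)
    (hr1 : r ≤ 1) {t s : ℝ} (ht : t ∈ liftSet X) (hs : s ∈ liftSet X) (k : ℕ) :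
    (liftStep X r)^[k] s = t ↔
      (liftBack X r)^[k] t ≤ s ∧ s < (liftBack X r)^[k] (liftNext X t) := by
  rw [iterate_liftBack_le_iff hX h hr hr1 ht hs, ← not_le,
    iterate_liftBack_le_iff hX h hr hr1 (liftNext_mem hX h t) hs, not_le]
  constructor
  · intro e; rw [e]; exact ⟨le_rfl, lt_liftNext hX h t⟩
  · rintro ⟨h1, h2⟩
    refine le_antisymm ?_ h1
    by_contra! h3
    exact absurd (liftNext_le hX h (iterate_liftStep_mem hX hr hs k) h3) (not_le.2 h2)

/-- A lifted point is determined by its class on the circle and its integer part, and both range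
over finite sets. -/
theorem finite_liftSet_inter (hX : X.Finite) (a b : ℝ) : (liftSet X ∩ Set.Icc a b).Finite := by
  refine Set.Finite.of_finite_image (f := fun t : ℝ => ((t : Circ), ⌊t⌋))
    (Set.Finite.subset (hX.prod (Set.finite_Icc ⌊a⌋ ⌊b⌋)) ?_) ?_
  · rintro _ ⟨t, ⟨ht, ht'⟩, rfl⟩
    exact ⟨ht, Int.floor_le_floor ht'.1, Int.floor_le_floor ht'.2⟩
  · rintro s - t - e
    simp only [Prod.mk.injEq] at e
    obtain ⟨n, hn⟩ := coe_eq_coe_iff.1 e.1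
    have h2 := e.2
    rw [hn, Int.floor_add_intCast] at h2
    have : n = 0 := by omega
    rw [hn, this]; simp

/-- The open arcs between nearby lifted points. -/
theorem openArc_disjoint_iff {a y : ℝ} (hay : a < y) (hya : y < a + 1) :
    (∀ t ∈ X, t ∉ openArc (a : Circ) y) ↔ ∀ s ∈ liftSet X, ¬ (a < s ∧ s < y) := by
  constructor
  · rintro h s hs ⟨h1, h2⟩
    refine h s hs ⟨?_, ?_⟩
    · rw [cdist_coe_of_le h1.le (by linarith)]; linarith
    · rw [cdist_coe_of_le h1.le (by linarith), cdist_coe_of_le hay.le hya]; linarith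
  · rintro h t ht ⟨h1, h2⟩
    rw [cdist_coe_of_le hay.le hya] at h2
    refine h (a + cdist a t) ?_ ⟨by linarith, by linarith⟩
    show ((a + cdist a t : ℝ) : Circ) ∈ X
    rwa [AddCircle.coe_add, add_coe_cdist]

end

/-! ### Swift points and periodicity on the lifted line -/

section

variable {X : Set Circ} {η : ℝ} {p q : ℕ}

theorem ratio_pos (hp : 0 < p) (hpq : p ≤ q) : (0 : ℝ) < (p : ℝ) / q := by
  have : 0 < q := hp.trans_le hpq
  positivity

theorem ratio_le_one (hpq : p ≤ q) : (p : ℝ) / q ≤ 1 :=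
  div_le_one_of_le₀ (by exact_mod_cast hpq) (by positivity)

theorem mul_ratio (hp : 0 < p) (hpq : p ≤ q) : (q : ℝ) * ((p : ℝ) / q) = p := by
  have : (q : ℝ) ≠ 0 := by exact_mod_cast (hp.trans_le hpq).ne'
  field_simp

/-- Each step falls short of `r` by less than `η`, so after `q` steps the walk lies in the interval
`(s + p - 1, s + p)`. The closing arc therefore ends at `s + p`, and the sum telescopes to `p`. -/
theorem wind_eq (hX : X.Finite) (h : IsFine X η) (hp : 0 < p) (hpq : p ≤ q) (hη : q * η < 1)
    {s : ℝ} (hs : s ∈ liftSet X) :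
    wind q (fun k => (step X ((p : ℝ) / q))^[k] (s : Circ)) = p := by
  have hr := ratio_pos hp hpq
  have hr1 := ratio_le_one hpq
  have hqr := mul_ratio hp hpq
  have hq : 0 < q := hp.trans_le hpq
  set r := (p : ℝ) / q
  have h1 : ∀ k, cdist ((step X r)^[k] (s : Circ)) ((step X r)^[k + 1] (s : Circ))
      = (liftStep X r)^[k + 1] s - (liftStep X r)^[k] s := by
    intro k
    rw [Function.iterate_succ_apply', Function.iterate_succ_apply', liftStep,
      ← coe_iterate_liftStep]
    ring
  have h2 := iterate_liftStep_lt hX hr hs hq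
  have h3 := le_iterate_liftStep hX h hr hr1 hs q
  rw [hqr] at h2 h3
  have h4 : cdist ((step X r)^[q] (s : Circ)) s = s + p - (liftStep X r)^[q] s := by
    rw [← coe_iterate_liftStep, ← coe_add_int s p, cdist_coe_of_le]
    · push_cast; ring
    · push_cast; linarith
    · push_cast; linarith
  simp only [wind, h1, Function.iterate_zero, id_eq, h4]
  rw [Finset.sum_range_sub (fun k => (liftStep X r)^[k] s)]
  simp

/-- The preimage of `t` under `j` steps is the interval from `B^j t` up to, but excluding, `s = B^j
(N t)`. The first inequality says that it is nonempty, and then `s` is the first point after it. The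
second is the only nontrivial half of the condition that `q + j` steps carry `s - p` to `t`. The
bound on `η` keeps all points involved within one turn, so that equalities on the circle lift to
equalities on the line. -/
theorem exists_swift_iff (hX : X.Finite) (h : IsFine X η) (hp : 0 < p) (hpq : p ≤ q) {j : ℕ}
    (hη0 : 0 < η) (hη : (q + 2 * j + 2) * η < 1) {t : ℝ} (ht : t ∈ liftSet X) :
    (∃ y, IsSwift X p q j y ∧ (step X ((p : ℝ) / q))^[q + j] y = t) ↔
      (liftBack X ((p : ℝ) / q))^[j] t < (liftBack X ((p : ℝ) / q))^[j] (liftNext X t) ∧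
      (liftBack X ((p : ℝ) / q))^[q + j] t ≤
        (liftBack X ((p : ℝ) / q))^[j] (liftNext X t) - p := by
  have hr := ratio_pos hp hpq
  have hr1 := ratio_le_one hpq
  have hqr := mul_ratio hp hpq
  have hq : 0 < q := hp.trans_le hpq
  have hqη : q * η < 1 := by nlinarith [hη0, (Nat.cast_nonneg j : (0 : ℝ) ≤ j)]
  have hwind := fun s hs => wind_eq hX h hp hpq hqη (s := s) hs
  simp only [IsSwift]
  set r := (p : ℝ) / q
  have hjη : (0 : ℝ) ≤ j * η := by positivity
  have hqη0 : (0 : ℝ) ≤ q * η := by positivity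
  have hη' : q * η + 2 * (j * η) + 2 * η < 1 := by linarith
  have hN := liftNext_mem hX h t
  have hbm := fun k => iterate_liftBack_mem hX h (r := r) ht k
  have hbm' := fun k => iterate_liftBack_mem hX h (r := r) hN k
  have htN := lt_liftNext hX h t
  have htN' := liftNext_lt hX h t
  constructor
  · rintro ⟨y, ⟨hyX, -, -, hyA, a, ⟨haX, ha⟩, harc⟩, hy⟩
    rw [hy] at ha hyA
    -- choose the lift of `y` for which `q + j` steps lead to `t + p`
    obtain ⟨s, rfl⟩ := coe_surj y
    rw [← coe_iterate_liftStep, coe_eq_coe_iff] at hy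
    obtain ⟨n, hn⟩ := hy
    obtain ⟨s', hs', hs'e⟩ : ∃ s' : ℝ, (s' : Circ) = s ∧ (liftStep X r)^[q + j] s' = t + p := by
      refine ⟨s + ((n + p : ℤ) : ℝ), coe_add_int _ _, ?_⟩
      rw [iterate_liftStep_add_int, hn]; push_cast; ring
    rw [← hs'] at hyX hyA harc
    clear hn hs' s
    rename' s' => s
    -- the lift of `a` just before `s`
    have hne : a ≠ (s : Circ) := by
      rintro rfl; exact hyA ⟨hyX, ha⟩
    obtain ⟨b, rfl, hb1, hb2⟩ : ∃ b : ℝ, (b : Circ) = a ∧ b < s ∧ s < b + 1 := by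
      refine ⟨s - cdist a s, ?_, ?_, ?_⟩
      · rw [AddCircle.coe_sub, coe_cdist]; abel
      · linarith [cdist_pos_iff.2 hne.symm]
      · linarith [cdist_lt_one a s]
    have hb : b ∈ liftSet X := haX
    have hs : s ∈ liftSet X := hyX
    rw [openArc_disjoint_iff hb1 hb2] at harc
    have hsb : s < b + η := by
      have h1 := liftNext_lt hX h b
      have h2 := lt_liftNext hX h b
      by_contra! h3
      exact harc _ (liftNext_mem hX h b) ⟨h2, by linarith⟩
    have hbt : (liftStep X r)^[j] b = t := by
      rw [← coe_iterate_liftStep, coe_eq_coe_iff] at ha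
      obtain ⟨m, hm⟩ := ha
      have e1 := iterate_liftStep_le hX hr hb j
      have e2 := le_iterate_liftStep hX h hr hr1 hb j
      have e3 := iterate_liftStep_le hX hr hs (q + j)
      have e4 := le_iterate_liftStep hX h hr hr1 hs (q + j)
      push_cast at e3 e4
      -- Both `t` and `(liftStep X r)^[j] b` lie less than one turn below `s + j * r`, so two lifts
      -- of the same point must coincide.
      have m0 : m = 0 := by
        have a1 : (m : ℝ) < 1 := by linarith
        have a2 : (-1 : ℝ) < m := by linarith
        have b1 : m < 1 := by exact_mod_cast a1
        have b2 : -1 < m := by exact_mod_cast a2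
        omega
      rw [hm, m0]; simp
    have hst : (liftStep X r)^[j] s ≠ t := by
      intro e
      apply hyA
      refine ⟨hyX, ?_⟩
      rw [← coe_iterate_liftStep, e]
    rw [iterate_liftStep_eq_iff hX h hr hr1 ht hb] at hbt
    rw [Ne, iterate_liftStep_eq_iff hX h hr hr1 ht hs, not_and, not_lt] at hst
    have hs2 : (liftBack X r)^[j] (liftNext X t) ≤ s := hst (by linarith)
    have hs3 : (liftBack X r)^[j] (liftNext X t) = s := by
      refine le_antisymm hs2 ?_
      by_contra! h3
      exact harc _ (hbm' j) ⟨hbt.2, h3⟩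
    rw [hs3]
    refine ⟨by linarith, ?_⟩
    have hsp : s - p ∈ liftSet X := by
      have := liftSet_add_int (-(p : ℤ)) hs
      push_cast at this
      rwa [← sub_eq_add_neg] at this
    rw [iterate_liftBack_le_iff hX h hr hr1 ht hsp]
    have := iterate_liftStep_add_int (X := X) r (s - p) p (q + j)
    push_cast at this
    rw [sub_add_cancel, hs'e] at this
    linarith
  · rintro ⟨h1, h2⟩
    set s := (liftBack X r)^[j] (liftNext X t) with hsdef
    have hs : s ∈ liftSet X := hbm' j
    have hsp : s - p ∈ liftSet X := by
      have := liftSet_add_int (-(p : ℤ)) hs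
      push_cast at this
      rwa [← sub_eq_add_neg] at this
    -- Going back `q` times from `s` moves down by less than `q * r = p`, because each successor
    -- lies strictly beyond its base point.
    have hlt : s - p < (liftBack X r)^[q + j] (liftNext X t) := by
      rw [Function.iterate_add_apply, ← hsdef]
      have hqq : q = q - 1 + 1 := by omega
      have := le_iterate_liftBack hX h (r := r) s (q - 1)
      have h' := lt_liftNext hX h ((liftBack X r)^[q - 1] s - r)
      have hc : ((q - 1 : ℕ) : ℝ) = q - 1 := by push_cast [Nat.cast_sub hq]; ring
      rw [hqq, Function.iterate_succ_apply', liftBack]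
      rw [hc] at this
      linarith
    have hF : (liftStep X r)^[q + j] (s - p) = t :=
      (iterate_liftStep_eq_iff hX h hr hr1 ht hsp (q + j)).2 ⟨h2, hlt⟩
    have hy : (step X r)^[q + j] (s : Circ) = t := by
      have := iterate_liftStep_add_int (X := X) r (s - p) p (q + j)
      push_cast at this
      rw [sub_add_cancel, hF] at this
      rw [← coe_iterate_liftStep, this]
      exact_mod_cast coe_add_int t p
    refine ⟨s, ⟨hs, hwind s hs, hs, ?_, ?_⟩, hy⟩
    · rw [hy]
      rintro ⟨-, hA⟩
      rw [← coe_iterate_liftStep, coe_eq_coe_iff] at hA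
      obtain ⟨n, hn⟩ := hA
      have e1 := le_iterate_liftStep hX h hr hr1 hs j
      have e2 := iterate_liftStep_le hX hr hs j
      have e3 := le_iterate_liftBack hX h (r := r) (liftNext X t) j
      have e4 := iterate_liftBack_le hX h (r := r) (liftNext X t) j
      have n0 : n = 0 := by
        have a1 : (n : ℝ) < 1 := by linarith
        have a2 : (-1 : ℝ) < n := by linarith
        have b1 : n < 1 := by exact_mod_cast a1
        have b2 : -1 < n := by exact_mod_cast a2
        omega
      rw [n0] at hn
      have hn' : (liftStep X r)^[j] s = t := by rw [hn]; simp
      rw [iterate_liftStep_eq_iff hX h hr hr1 ht hs] at hn'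
      exact lt_irrefl _ hn'.2
    · rw [hy]
      -- With radius `1` the furthest point from `s` is the last one before a full turn; subtracting
      -- `1` gives the predecessor `b` of `s` in the lifted set.
      have b0 := liftStep_mem hX one_pos hs
      have b1 := liftStep_lt hX one_pos hs
      set b := liftStep X 1 s - 1 with hbdef
      have hb : b ∈ liftSet X := by
        have := liftSet_add_int (-1) b0
        push_cast at this
        rwa [← sub_eq_add_neg] at this
      have hbs : b < s := by linarith
      have hsb : s ≤ b + 1 := by linarith [le_liftStep (X := X) 1 s]
      have hmax : ∀ c ∈ liftSet X, c < s → c ≤ b := by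
        intro c hc hcs
        have := liftSet_add_int 1 hc
        have := le_liftStep_of_lt hX one_pos le_rfl hs this (by push_cast; linarith)
        push_cast at this; linarith
      have hsb' : s < b + 1 := by
        have h3 := hmax _ (liftNext_mem hX h (s - η))
        have h4 := liftNext_lt hX h (s - η)
        have h5 := lt_liftNext hX h (s - η)
        have h6 := h3 (by linarith)
        have : η ≤ 2 * η := by linarith
        linarith
      refine ⟨(b : Circ), ⟨hb, ?_⟩, ?_⟩
      · rw [← coe_iterate_liftStep,
          (iterate_liftStep_eq_iff hX h hr hr1 ht hb j).2 ⟨hmax _ (hbm j) h1, hbs⟩]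
      · rw [openArc_disjoint_iff hbs hsb']
        rintro c hc ⟨hc1, hc2⟩
        exact absurd (hmax c hc hc2) (not_le.2 hc1)

/-- A periodic point has a preimage under every iterate, so the interval of its `j`-fold preimages
is nonempty. -/
theorem IsPeriodic.iterate_liftBack_lt (hX : X.Finite) (h : IsFine X η) {r : ℝ} (hr : 0 < r)
    (hr1 : r ≤ 1) {t : ℝ} (hper : IsPeriodic X r t) (j : ℕ) :
    (liftBack X r)^[j] t < (liftBack X r)^[j] (liftNext X t) := by
  obtain ⟨htX, k, hk, hkt⟩ := hper
  have ht : t ∈ liftSet X := htX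
  -- A preimage under `j` steps is found on the orbit itself: `k * j` steps return to `t`.
  have hs := iterate_liftStep_mem hX hr ht (k * j - j)
  have e : (step X r)^[j] (((liftStep X r)^[k * j - j] t : ℝ) : Circ) = t := by
    rw [coe_iterate_liftStep, ← Function.iterate_add_apply,
      Nat.add_sub_cancel' (Nat.le_mul_of_pos_left j hk), Function.iterate_mul,
      Function.iterate_fixed hkt]
  rw [← coe_iterate_liftStep, coe_eq_coe_iff] at e
  obtain ⟨n, hn⟩ := e
  rw [← iterate_liftStep_add_int, eq_comm,
    iterate_liftStep_eq_iff hX h hr hr1 ht (liftSet_add_int n hs)] at hn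
  exact hn.1.trans_lt hn.2

/-- The map `G = F^q - p` moves every lifted point strictly backward, commutes with `F^i` and is
monotone. Let `z = F^i (B^i (N t))`. The image of `F^i` has no point strictly between `t` and `z`,
and the hypothesis says `t ≤ G z`. An orbit of `G` that starts at a translate of `t` above `z` stays
in the image of `F^i`; when it first drops below `z` it lands at most at `t` by the gap and at least
at `t` by monotonicity, hence exactly at `t`. -/
theorem isPeriodic_of_swift (hX : X.Finite) (h : IsFine X η) (hp : 0 < p) (hpq : p ≤ q) {i : ℕ}
    {t : ℝ} (ht : t ∈ liftSet X)
    (h1 : (liftBack X ((p : ℝ) / q))^[i] t < (liftBack X ((p : ℝ) / q))^[i] (liftNext X t))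
    (h2 : (liftBack X ((p : ℝ) / q))^[q + i] t ≤
        (liftBack X ((p : ℝ) / q))^[i] (liftNext X t) - p) :
    IsPeriodic X ((p : ℝ) / q) t := by
  have hr := ratio_pos hp hpq
  have hr1 := ratio_le_one hpq
  have hqr := mul_ratio hp hpq
  have hq : 0 < q := hp.trans_le hpq
  set r := (p : ℝ) / q
  -- the lift of the `q`-th iterate which moves backward
  set G : ℝ → ℝ := fun s => (liftStep X r)^[q] s + ((-(p : ℤ) : ℤ) : ℝ) with hG
  have hGmem : ∀ s ∈ liftSet X, G s ∈ liftSet X := fun s hs =>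
    liftSet_add_int _ (iterate_liftStep_mem hX hr hs q)
  have hGlt : ∀ s ∈ liftSet X, G s < s := by
    intro s hs
    have := iterate_liftStep_lt hX hr hs hq
    simp only [hG]; push_cast; linarith
  have hGmono : ∀ a ∈ liftSet X, ∀ b ∈ liftSet X, a ≤ b → G a ≤ G b := by
    intro a ha b hb hab
    have := iterate_liftStep_mono hX hr hr1 ha hb hab q
    simp only [hG]; linarith
  have hGcomm : ∀ s, G ((liftStep X r)^[i] s) = (liftStep X r)^[i] (G s) := by
    intro s
    simp only [hG, iterate_liftStep_add_int, ← Function.iterate_add_apply, add_comm]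
  have hGkmem : ∀ k, ∀ s ∈ liftSet X, G^[k] s ∈ liftSet X := by
    intro k s hs
    induction k with
    | zero => exact hs
    | succ k ih => rw [Function.iterate_succ_apply']; exact hGmem _ ih
  have hGkcomm : ∀ k s, G^[k] ((liftStep X r)^[i] s) = (liftStep X r)^[i] (G^[k] s) := by
    intro k s
    induction k with
    | zero => rfl
    | succ k ih => rw [Function.iterate_succ_apply', Function.iterate_succ_apply', ih, hGcomm]
  have hGk : ∀ k s, ((G^[k] s : ℝ) : Circ) = (step X r)^[q * k] (s : Circ) := by
    intro k s
    induction k with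
    | zero => rfl
    | succ k ih =>
      rw [Function.iterate_succ_apply']
      show (((liftStep X r)^[q] (G^[k] s) + ((-(p : ℤ) : ℤ) : ℝ) : ℝ) : Circ) = _
      rw [coe_add_int, coe_iterate_liftStep, ih, ← Function.iterate_add_apply]
      congr 1; ring_nf
  set y := (liftBack X r)^[i] (liftNext X t) with hy
  have hN := liftNext_mem hX h t
  have hym : y ∈ liftSet X := iterate_liftBack_mem hX h hN i
  set z := (liftStep X r)^[i] y with hz
  have hzm : z ∈ liftSet X := iterate_liftStep_mem hX hr hym i
  have hGz : t ≤ G z := by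
    rw [hz, hGcomm]
    have hyp : y - p ∈ liftSet X := by
      have := liftSet_add_int (-(p : ℤ)) hym
      push_cast at this
      rwa [← sub_eq_add_neg] at this
    rw [iterate_liftBack_le_iff hX h hr hr1 ht hyp] at h2
    have : (liftStep X r)^[i] (G y) = (liftStep X r)^[q + i] (y - p) := by
      have e' : y - p = y + ((-(p : ℤ) : ℤ) : ℝ) := by push_cast; ring
      rw [e', iterate_liftStep_add_int r y, add_comm q i, Function.iterate_add_apply]
      exact iterate_liftStep_add_int r _ _ i
    rw [this]; exact h2
  -- no point of the `i`-th image lies strictly between `t` and `z`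
  have hgap : ∀ s ∈ liftSet X, (liftStep X r)^[i] s < z → (liftStep X r)^[i] s ≤ t := by
    intro s hs hsz
    have hsy : s < y := by
      by_contra! hc
      exact absurd (iterate_liftStep_mono hX hr hr1 hym hs hc i) (not_le.2 hsz)
    by_contra! hc
    have := liftNext_le hX h (iterate_liftStep_mem hX hr hs i) hc
    rw [← iterate_liftBack_le_iff hX h hr hr1 hN hs] at this
    linarith
  set s₀ := (liftBack X r)^[i] t with hs₀
  have hs₀m : s₀ ∈ liftSet X := iterate_liftBack_mem hX h ht i
  have hs₀t : (liftStep X r)^[i] s₀ = t :=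
    (iterate_liftStep_eq_iff hX h hr hr1 ht hs₀m i).2 ⟨le_rfl, h1⟩
  obtain ⟨M, hM⟩ := exists_int_gt (z - t)
  have hs₁m := liftSet_add_int M hs₀m
  set s₁ := s₀ + M with hs₁
  have hs₁t : (liftStep X r)^[i] s₁ = t + M := by rw [hs₁, iterate_liftStep_add_int, hs₀t]
  -- Otherwise the strictly decreasing orbit would lie in a bounded window, which contains only
  -- finitely many lifted points.
  have hex : ∃ k, G^[k] (t + M) < z := by
    by_contra! hc
    have hanti : StrictAnti fun k => G^[k] (t + M) := strictAnti_nat_of_succ_lt fun k => by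
      rw [Function.iterate_succ_apply']
      exact hGlt _ (hGkmem k _ (liftSet_add_int M ht))
    refine Set.infinite_of_injective_forall_mem hanti.injective (fun k => ?_)
      (finite_liftSet_inter hX z (t + M))
    exact ⟨hGkmem k _ (liftSet_add_int M ht), hc k, hanti.antitone (Nat.zero_le k)⟩
  classical
  have hk := Nat.find_spec hex
  set k := Nat.find hex with hkdef
  have hk0 : k ≠ 0 := by
    intro h0
    rw [h0] at hk
    simp only [Function.iterate_zero, id_eq] at hk
    linarith
  obtain ⟨l, hl⟩ := Nat.exists_eq_succ_of_ne_zero hk0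
  have hlz : z ≤ G^[l] (t + M) := not_lt.1 (Nat.find_min hex (by omega))
  have hkt : G^[k] (t + M) = t := by
    apply le_antisymm
    · rw [← hs₁t, hGkcomm] at hk ⊢
      exact hgap _ (hGkmem k _ hs₁m) hk
    · rw [hl, Function.iterate_succ_apply']
      exact hGz.trans (hGmono _ hzm _ (hGkmem l _ (liftSet_add_int M ht)) hlz)
  refine ⟨ht, q * k, Nat.mul_pos hq (Nat.pos_of_ne_zero hk0), ?_⟩
  rw [← coe_add_int t M, ← hGk, hkt, coe_add_int]

end

/-! ### Swiftness types and gaps -/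

/-- Distinct points of `X` never differ by a multiple of `r`. -/
def IsGeneric (X : Set Circ) (r : ℝ) : Prop :=
  ∀ s ∈ X, ∀ t ∈ X, s ≠ t → ∀ n : ℤ, s - t ≠ ((n * r : ℝ) : Circ)

theorem sum_fin_filter_lt {m k : ℕ} (hk : k ≤ m) (f : ℕ → ℝ) :
    ∑ l : Fin m with l.val < k, f l = ∑ l ∈ Finset.range k, f l := by
  rw [Finset.sum_filter, Fin.sum_univ_eq_sum_range (fun l => if l < k then f l else 0) m,
    ← Finset.sum_filter]
  congr 1
  ext l
  simp only [Finset.mem_filter, Finset.mem_range]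
  omega

theorem coe_eq_zero_of_ratio {p q : ℕ} (hq : 0 < q) (hcop : Nat.Coprime p q) {n : ℤ}
    (h : ((n * ((p : ℝ) / q) : ℝ) : Circ) = 0) : (q : ℤ) ∣ n := by
  have h' : ((0 : ℝ) : Circ) = ((n * ((p : ℝ) / q) : ℝ) : Circ) := by rw [h]; rfl
  obtain ⟨k, hk⟩ := coe_eq_coe_iff.1 h'
  have hq' : (q : ℝ) ≠ 0 := by exact_mod_cast hq.ne'
  have e : (n : ℝ) * p = q * k := by field_simp at hk; linarith
  have e' : n * p = q * k := by exact_mod_cast e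
  have hc : IsCoprime (q : ℤ) (p : ℤ) := Nat.isCoprime_iff_coprime.2 hcop.symm
  exact hc.dvd_of_dvd_mul_right ⟨k, e'⟩

section

variable {X : Set Circ} {η : ℝ}

theorem back_coe (r t : ℝ) (j : ℕ) : back X r (t : Circ) j = ((liftBack X r)^[j] t : ℝ) := by
  induction j with
  | zero => rfl
  | succ j ih =>
    rw [back, ih, Function.iterate_succ_apply', liftBack, coe_liftNext, AddCircle.coe_sub]

theorem wgap_coe (r t : ℝ) (j : ℕ) :
    wgap X r t j = (liftBack X r)^[j + 1] t - (liftBack X r)^[j] t + r := by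
  show cdist (back X r t j - (r : Circ)) (next X (back X r t j - (r : Circ))) = _
  rw [back_coe, Function.iterate_succ_apply', ← AddCircle.coe_sub]
  simp only [liftBack, liftNext]
  ring

theorem zgap_zero_coe (r t : ℝ) : zgap X r t 0 = liftNext X t - t := by
  rw [zgap, ys, back, liftNext]; ring

theorem zgap_succ_coe (r t : ℝ) (j : ℕ) :
    zgap X r t (j + 1) =
      (liftBack X r)^[j + 1] (liftNext X t) - (liftBack X r)^[j] (liftNext X t) + r := by
  show cdist (back X r (next X t) j - (r : Circ)) (next X (back X r (next X t) j - (r : Circ))) = _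
  rw [← coe_liftNext, back_coe, Function.iterate_succ_apply', ← AddCircle.coe_sub]
  generalize (liftBack X r)^[j] (liftNext X t) = a
  simp only [liftBack, liftNext]
  ring

theorem sum_wgap (r t : ℝ) (k : ℕ) :
    ∑ l ∈ Finset.range k, wgap X r t l = (liftBack X r)^[k] t - t + k * r := by
  induction k with
  | zero => simp
  | succ k ih => rw [Finset.sum_range_succ, ih, wgap_coe]; push_cast; ring

theorem sum_zgap (r t : ℝ) (j : ℕ) :
    ∑ l ∈ Finset.range (j + 1), zgap X r t l = (liftBack X r)^[j] (liftNext X t) - t + j * r := by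
  induction j with
  | zero => simp [zgap_zero_coe]
  | succ k ih => rw [Finset.sum_range_succ, ih, zgap_succ_coe]; push_cast; ring

theorem H_gaps_iff {m j k : ℕ} (hj : j + 1 ≤ m) (hk : k ≤ m) (r t : ℝ) :
    H (j + 1) k (gaps m X r t) ↔
      (liftBack X r)^[k] t + k * r ≤ (liftBack X r)^[j] (liftNext X t) + j * r := by
  simp only [H, gaps]
  rw [sum_fin_filter_lt hj (fun l => zgap X r t l), sum_fin_filter_lt hk (fun l => wgap X r t l),
    sum_wgap, sum_zgap]
  constructor <;> intro h <;> linarith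

theorem zgap_nonneg (r : ℝ) (x : Circ) (j : ℕ) : 0 ≤ zgap X r x j := by
  cases j <;> exact cdist_nonneg _ _

theorem wgap_nonneg (r : ℝ) (x : Circ) (j : ℕ) : 0 ≤ wgap X r x j := cdist_nonneg _ _

/-- The sums telescope to `B^(j+1) t ≤ B^j (N t) - r`. The right side of the equivalence compares
the lifted point `B^(j+1) t` with the successor of `B^j (N t) - r`, which turns `≤` into `<`. The
extra gap `z_1` from `t` to `N t` accounts for the shift of one between the exponents. -/
theorem H_diag_gaps_iff (hX : X.Finite) (h : IsFine X η) {m j : ℕ} (hj : j + 1 ≤ m) {r t : ℝ}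
    (ht : t ∈ liftSet X) :
    H (j + 1) (j + 1) (gaps m X r t) ↔
      (liftBack X r)^[j + 1] t < (liftBack X r)^[j + 1] (liftNext X t) := by
  rw [H_gaps_iff hj hj, Function.iterate_succ_apply' _ _ (liftNext X t)]
  constructor
  · intro h'
    have := lt_liftNext hX h ((liftBack X r)^[j] (liftNext X t) - r)
    rw [liftBack]
    push_cast at h'
    linarith
  · intro h'
    by_contra! h2
    push_cast at h2
    have := liftNext_le hX h (a := (liftBack X r)^[j] (liftNext X t) - r)
      (iterate_liftBack_mem hX h ht (j + 1) (r := r)) (by linarith)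
    rw [liftBack] at h'
    linarith

/-- With `a = B^(j+q-1) t` and `b = B^j (N t)`, the left side reads `a - r ≤ b - p`, whereas the
right side says that the successor of `a - r` is at most `b - p`, that is, `a - r < b - p`.
Genericity rules out equality between distinct points of the circle; for equal ones, equality would
make `(1 - q) * p / q` an integer, impossible for `q ≥ 2`. -/
theorem H_shift_gaps_iff (hX : X.Finite) (h : IsFine X η) {p q m j : ℕ} (hp : 0 < p) (hpq : p ≤ q)
    (hcop : Nat.Coprime p q) (hq : 2 ≤ q) (hgen : IsGeneric X ((p : ℝ) / q)) (hj : j + q ≤ m + 1)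
    {t : ℝ} (ht : t ∈ liftSet X) :
    H (j + 1) (j + q - 1) (gaps m X ((p : ℝ) / q) t) ↔
      (liftBack X ((p : ℝ) / q))^[q + j] t ≤
        (liftBack X ((p : ℝ) / q))^[j] (liftNext X t) - p := by
  have hqr := mul_ratio hp hpq
  have hne : ∀ n : ℤ, (n : ℝ) * ((p : ℝ) / q) = (1 - q : ℤ) * ((p : ℝ) / q) →
      ((n * ((p : ℝ) / q) : ℝ) : Circ) ≠ 0 := by
    intro n hn h0
    rw [hn] at h0
    have := coe_eq_zero_of_ratio (by omega) hcop h0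
    have h1 : (q : ℤ) ∣ 1 := by simpa using dvd_add this (dvd_refl (q : ℤ))
    have := Int.le_of_dvd one_pos h1
    omega
  set r := (p : ℝ) / q
  rw [H_gaps_iff (by omega) (by omega)]
  obtain ⟨k, hk⟩ : ∃ k, j + q = k + 1 := ⟨j + q - 1, by omega⟩
  have hk' : j + q - 1 = k := by omega
  have hkr : (k : ℝ) = j + q - 1 := by
    have : ((j + q : ℕ) : ℝ) = k + 1 := by rw [hk]; push_cast; ring
    push_cast at this; linarith
  rw [hk', add_comm q j, hk, Function.iterate_succ_apply', hkr]
  have hN := liftNext_mem hX h t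
  have h1 := iterate_liftBack_mem hX h ht k (r := r)
  have h2 := iterate_liftBack_mem hX h hN j (r := r)
  set a := (liftBack X r)^[k] t
  set b := (liftBack X r)^[j] (liftNext X t)
  have h2p : b - p ∈ liftSet X := by
    have := liftSet_add_int (-(p : ℤ)) h2
    push_cast at this
    rwa [← sub_eq_add_neg] at this
  have hab : a - r ≠ b - p := by
    intro e
    have e1 : (a : Circ) - b = ((((1 - q : ℤ) : ℝ) * r : ℝ) : Circ) := by
      rw [← AddCircle.coe_sub]; congr 1; push_cast; linarith
    by_cases e2 : (a : Circ) = b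
    · rw [e2, sub_self] at e1
      exact hne _ rfl e1.symm
    · exact hgen _ h1 _ h2 e2 _ e1
  constructor
  · intro h'
    exact liftNext_le hX h h2p (lt_of_le_of_ne (by linarith) hab)
  · intro h'
    have := lt_liftNext hX h (a - r)
    rw [liftBack] at h'
    linarith

theorem liftNext_add_int (a : ℝ) (n : ℤ) : liftNext X (a + n) = liftNext X a + n := by
  simp only [liftNext, coe_add_int]; ring

theorem isOfType_iff (hX : X.Finite) (h : IsFine X η) {p q i : ℕ} (hp : 0 < p) (hpq : p ≤ q)
    (hcop : Nat.Coprime p q) (hη0 : 0 < η) (hη : (q + 2 * i + 2) * η < 1)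
    (hgen : IsGeneric X ((p : ℝ) / q)) {x : Circ} (hx : x ∈ X) :
    IsOfType X p q i x ↔ gaps (i + q - 1) X ((p : ℝ) / q) x ∈ S q i := by
  obtain ⟨t, rfl⟩ := coe_surj x
  have ht : t ∈ liftSet X := hx
  have hswift : ∀ j ≤ i, _ := fun j (hj : j ≤ i) => exists_swift_iff hX h hp hpq (j := j) hη0
    (lt_of_le_of_lt (by
      have : (j : ℝ) ≤ i := by exact_mod_cast hj
      gcongr) hη) ht
  have hpos1 : ∀ l, 0 ≤ (gaps (i + q - 1) X ((p : ℝ) / q) (t : Circ)).1 l :=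
    fun l => zgap_nonneg _ _ _
  have hpos2 : ∀ l, 0 ≤ (gaps (i + q - 1) X ((p : ℝ) / q) (t : Circ)).2 l :=
    fun l => wgap_nonneg _ _ _
  rcases lt_or_ge 1 q with hq | hq
  · have hshift := fun j (hj : j ≤ i) => H_shift_gaps_iff hX h hp hpq hcop hq hgen
      (m := i + q - 1) (j := j) (by omega) ht
    constructor
    · rintro ⟨hper, hmem, hleast⟩
      have hlt := hper.iterate_liftBack_lt hX h (ratio_pos hp hpq) (ratio_le_one hpq)
      refine ⟨hpos1, hpos2, ?_, ?_, ?_⟩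
      · intro j hj1 hj2
        obtain ⟨j, rfl⟩ := Nat.exists_eq_succ_of_ne_zero (by omega : j ≠ 0)
        exact (H_diag_gaps_iff hX h hj2 ht).2 (hlt _)
      · intro j hj1 hj2 hH
        obtain ⟨j, rfl⟩ := Nat.exists_eq_succ_of_ne_zero (by omega : j ≠ 0)
        rw [show j.succ + q - 2 = j + q - 1 by omega] at hH
        have := hleast ((hswift j (by omega)).2 ⟨hlt j, (hshift j (by omega)).1 hH⟩)
        omega
      · exact (hshift i le_rfl).2 ((hswift i le_rfl).1 hmem).2
    · rintro ⟨-, -, hdiag, hnot, hlast⟩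
      have hlt : ∀ j ≤ i, (liftBack X ((p : ℝ) / q))^[j] t
          < (liftBack X ((p : ℝ) / q))^[j] (liftNext X t) := by
        intro j hj
        cases j with
        | zero => exact lt_liftNext hX h t
        | succ j => exact (H_diag_gaps_iff hX h (by omega) ht).1 (hdiag _ (by omega) (by omega))
      have h1 := hlt i le_rfl
      have h2 := (hshift i le_rfl).1 hlast
      refine ⟨isPeriodic_of_swift hX h hp hpq ht h1 h2, (hswift i le_rfl).2 ⟨h1, h2⟩, ?_⟩
      intro j hj
      by_contra! hji
      refine hnot (j + 1) (by omega) (by omega) ?_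
      rw [show j + 1 + q - 2 = j + q - 1 by omega]
      exact (hshift j hji.le).2 ((hswift j hji.le).1 hj).2
  -- For `q = 1` one has `B t = N t - 1`, so the criterion holds with `j = 0` at every point and all
  -- points have type `0`. Correspondingly the cone is the whole zero-dimensional space for `i = 0`.
  · obtain rfl : p = 1 := by omega
    obtain rfl : q = 1 := by omega
    have h1 : (liftBack X (((1 : ℕ) : ℝ) / ((1 : ℕ) : ℝ)))^[0] t
        < (liftBack X (((1 : ℕ) : ℝ) / ((1 : ℕ) : ℝ)))^[0] (liftNext X t) := lt_liftNext hX h t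
    have h2 : (liftBack X (((1 : ℕ) : ℝ) / ((1 : ℕ) : ℝ)))^[1 + 0] t ≤
        (liftBack X (((1 : ℕ) : ℝ) / ((1 : ℕ) : ℝ)))^[0] (liftNext X t) - ((1 : ℕ) : ℝ) := by
      have := liftNext_add_int (X := X) t (-1)
      push_cast at this
      simp only [add_zero, Function.iterate_one, Function.iterate_zero, id_eq, liftBack,
        Nat.cast_one, div_one, sub_eq_add_neg, this, le_refl]
    have h0 := (hswift 0 (Nat.zero_le _)).2 ⟨h1, h2⟩
    cases i with
    | zero =>
      refine ⟨fun _ => ⟨hpos1, hpos2, fun j _ _ => by omega, fun j _ _ => by omega, ?_⟩, fun _ =>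
        ⟨isPeriodic_of_swift hX h hp hpq ht h1 h2, h0, fun _ _ => Nat.zero_le _⟩⟩
      simp [H]
    | succ i =>
      constructor
      · rintro ⟨-, -, hleast⟩
        have := hleast h0
        omega
      · rintro ⟨-, -, -, hnot, -⟩
        -- For `q = 1` and positive `i` the cone is empty: `H 1 0` compares a nonnegative sum with
        -- the empty sum, so it cannot fail.
        refine absurd ?_ (hnot 1 le_rfl (by omega))
        simp only [H]
        rw [Finset.sum_eq_zero (by intro l hl; simp at hl)]
        exact Finset.sum_nonneg fun l _ => hpos1 l

end

/-! ### Measurability -/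

theorem IsFurthest.unique {X : Set Circ} {r : ℝ} {x y z : Circ} (hy : IsFurthest X r x y)
    (hz : IsFurthest X r x z) : y = z :=
  cdist_inj (le_antisymm (hz.2.2 y hy.1 hy.2.1) (hy.2.2 z hz.1 hz.2.1))

section

variable {n : ℕ} {f : (Fin n → Circ) → Circ}

theorem measurable_eval (k : Fin n) : Measurable fun ω : Fin n → Circ => ω k :=
  measurable_pi_apply k

/-- The value is one of the finitely many sample points, and the event that a given sample point is
selected is defined by finitely many comparisons of distances. -/
theorem measurable_step (hf : Measurable f) (hmem : ∀ ω, f ω ∈ Set.range ω) {r : ℝ} (hr : 0 < r) :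
    Measurable fun ω => step (Set.range ω) r (f ω) := by
  have hspec := fun ω => step_spec (Set.finite_range ω) hr (hmem ω)
  have hev : ∀ b : Fin n, Measurable fun ω : Fin n → Circ =>
      IsFurthest (Set.range ω) r (f ω) (ω b) := by
    intro b
    have e : (fun ω : Fin n → Circ => IsFurthest (Set.range ω) r (f ω) (ω b)) = fun ω =>
        cdist (f ω) (ω b) < r ∧ ∀ c : Fin n, cdist (f ω) (ω c) < r →
          cdist (f ω) (ω c) ≤ cdist (f ω) (ω b) := by
      ext ω; simp [IsFurthest]
    have hm := fun c => measurable_cdist hf (measurable_eval (n := n) c)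
    rw [e]
    exact (measurableSet_setOfPred.1 (measurableSet_lt (hm b) measurable_const)).and
      (Measurable.forall fun c => (measurableSet_setOfPred.1 (measurableSet_lt (hm c)
        measurable_const)).imp (measurableSet_setOfPred.1 (measurableSet_le (hm c) (hm b))))
  intro B hB
  have e : (fun ω => step (Set.range ω) r (f ω)) ⁻¹' B =
      {ω | ∃ b : Fin n, IsFurthest (Set.range ω) r (f ω) (ω b) ∧ ω b ∈ B} := by
    ext ω
    constructor
    · intro h
      obtain ⟨b, hb⟩ := (hspec ω).1
      exact ⟨b, hb ▸ hspec ω, by rw [hb]; exact h⟩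
    · rintro ⟨b, hb, hbB⟩
      show step (Set.range ω) r (f ω) ∈ B
      rwa [(hspec ω).unique hb]
  rw [e]
  exact measurableSet_setOfPred.2 (Measurable.exists fun b => (hev b).and
    (measurableSet_setOfPred.1 ((measurable_eval b) hB)))

theorem iterate_step_mem {X : Set Circ} (hX : X.Finite) {r : ℝ} (hr : 0 < r) {x : Circ}
    (hx : x ∈ X) (k : ℕ) : (step X r)^[k] x ∈ X := by
  induction k with
  | zero => exact hx
  | succ k ih => rw [Function.iterate_succ_apply']; exact step_mem hX hr ih

theorem measurable_iterate_step (hf : Measurable f) (hmem : ∀ ω, f ω ∈ Set.range ω) {r : ℝ}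
    (hr : 0 < r) (k : ℕ) : Measurable fun ω => (step (Set.range ω) r)^[k] (f ω) := by
  induction k with
  | zero => exact hf
  | succ k ih =>
    simp only [Function.iterate_succ_apply']
    exact measurable_step ih (fun ω => iterate_step_mem (Set.finite_range ω) hr (hmem ω) k) hr

theorem measurable_next (hf : Measurable f) : Measurable fun ω => next (Set.range ω) (f ω) := by
  have heq : ∀ c : Fin n, Measurable fun ω : Fin n → Circ => ω c = f ω := fun c =>
    measurableSet_setOfPred.1 (measurableSet_eq_fun (measurable_eval c) hf)
  have hev : ∀ b : Fin n, Measurable fun ω : Fin n → Circ => IsNext (Set.range ω) (f ω) (ω b) := by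
    intro b
    have e : (fun ω : Fin n → Circ => IsNext (Set.range ω) (f ω) (ω b)) = fun ω =>
        ¬ ω b = f ω ∧ ∀ c : Fin n, ¬ ω c = f ω → cdist (f ω) (ω b) ≤ cdist (f ω) (ω c) := by
      ext ω; simp [IsNext]
    have hm := fun c => measurable_cdist hf (measurable_eval (n := n) c)
    rw [e]
    exact (heq b).not.and (Measurable.forall fun c => (heq c).not.imp
      (measurableSet_setOfPred.1 (measurableSet_le (hm b) (hm c))))
  intro B hB
  have e : (fun ω => next (Set.range ω) (f ω)) ⁻¹' B =
      {ω | (∃ b : Fin n, IsNext (Set.range ω) (f ω) (ω b) ∧ ω b ∈ B) ∨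
        ((∀ c : Fin n, ω c = f ω) ∧ f ω ∈ B)} := by
    ext ω
    by_cases h : ∃ c : Fin n, ω c ≠ f ω
    · obtain ⟨c, hc⟩ := h
      have hs := next_spec (Set.finite_range ω) ⟨ω c, ⟨c, rfl⟩, hc⟩
      constructor
      · intro h
        obtain ⟨b, hb⟩ := hs.1
        exact Or.inl ⟨b, hb ▸ hs, by rw [hb]; exact h⟩
      · rintro (⟨b, hb, hbB⟩ | ⟨h, -⟩)
        · show next (Set.range ω) (f ω) ∈ B
          rwa [hb.next_eq]
        · exact absurd (h c) hc
    · push Not at h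
      have hs : next (Set.range ω) (f ω) = f ω := by
        rw [next, dif_neg]
        rintro ⟨y, ⟨c, rfl⟩, hne, -⟩
        exact hne (h c)
      constructor
      · intro h'
        exact Or.inr ⟨h, hs ▸ h'⟩
      · rintro (⟨b, hb, hbB⟩ | ⟨-, h'⟩)
        · exact absurd (h b) hb.2.1
        · show next (Set.range ω) (f ω) ∈ B
          rwa [hs]
  rw [e]
  exact measurableSet_setOfPred.2 ((Measurable.exists fun b => (hev b).and
    (measurableSet_setOfPred.1 ((measurable_eval b) hB))).or
      ((Measurable.forall heq).and (measurableSet_setOfPred.1 (hf hB))))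

theorem measurable_back (hf : Measurable f) (r : ℝ) (j : ℕ) :
    Measurable fun ω => back (Set.range ω) r (f ω) j := by
  induction j with
  | zero => exact hf
  | succ j ih => exact measurable_next (ih.sub measurable_const)

theorem measurable_gaps (hf : Measurable f) (r : ℝ) (m : ℕ) :
    Measurable fun ω => gaps m (Set.range ω) r (f ω) := by
  have hb := measurable_back hf r
  have hb' := measurable_back (measurable_next hf) r
  refine Measurable.prodMk (measurable_pi_lambda _ fun l => ?_) (measurable_pi_lambda _ fun l => ?_)
  · rcases l with ⟨l, hl⟩
    cases l with
    | zero => exact measurable_cdist hf (hb' 0)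
    | succ l => exact measurable_cdist ((hb' l).sub measurable_const) (hb' (l + 1))
  · exact measurable_cdist ((hb l).sub measurable_const) (hb (l + 1))

theorem measurableSet_H {m : ℕ} (j k : ℕ) : MeasurableSet {u : GapSpace m | H j k u} :=
  measurableSet_le
    (Finset.measurable_sum _ fun l _ => (measurable_pi_apply l).comp measurable_snd)
    (Finset.measurable_sum _ fun l _ => (measurable_pi_apply l).comp measurable_fst)

theorem measurableSet_S (q i : ℕ) : MeasurableSet (S q i) := by
  have hH := fun j k => measurableSet_setOfPred.1 (measurableSet_H (m := i + q - 1) j k)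
  have h1 : ∀ l, Measurable fun u : GapSpace (i + q - 1) => 0 ≤ u.1 l := fun l =>
    measurableSet_setOfPred.1 (measurableSet_le measurable_const
      ((measurable_pi_apply l).comp measurable_fst))
  have h2 : ∀ l, Measurable fun u : GapSpace (i + q - 1) => 0 ≤ u.2 l := fun l =>
    measurableSet_setOfPred.1 (measurableSet_le measurable_const
      ((measurable_pi_apply l).comp measurable_snd))
  exact measurableSet_setOfPred.2 ((Measurable.forall h1).and ((Measurable.forall h2).and
    ((Measurable.forall fun j => measurable_const.imp (measurable_const.imp (hH j j))).and
      ((Measurable.forall fun j => measurable_const.imp (measurable_const.imp (hH j _).not)).and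
        (hH _ _)))))

theorem measurableSet_gaps_mem (hf : Measurable f) (r : ℝ) (q i : ℕ) :
    MeasurableSet {ω | gaps (i + q - 1) (Set.range ω) r (f ω) ∈ S q i} :=
  measurable_gaps hf r _ (measurableSet_S q i)

theorem measurable_isSwift (hf : Measurable f) (hmem : ∀ ω, f ω ∈ Set.range ω) {p q : ℕ}
    (hp : 0 < p) (hpq : p ≤ q) (i : ℕ) :
    Measurable fun ω => IsSwift (Set.range ω) p q i (f ω) := by
  have hr := ratio_pos hp hpq
  set r := (p : ℝ) / q with hrdef
  have hit := fun k => measurable_iterate_step hf hmem hr k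
  have hcd := fun a b => measurable_cdist (hit a) (hit b)
  have e : (fun ω => IsSwift (Set.range ω) p q i (f ω)) = fun ω =>
      wind q (fun k => (step (Set.range ω) r)^[k] (f ω)) = p ∧
      ¬ (step (Set.range ω) r)^[i] (f ω) = (step (Set.range ω) r)^[q + i] (f ω) ∧
      ∃ a : Fin n, (step (Set.range ω) r)^[i] (ω a) = (step (Set.range ω) r)^[q + i] (f ω) ∧
        ∀ c : Fin n, ¬ (0 < cdist (ω a) (ω c) ∧ cdist (ω a) (ω c) < cdist (ω a) (f ω)) := by
    ext ω
    have : ∃ y, ω y = f ω := hmem ω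
    simp [IsSwift, IsFirstAfter, preim, openArc, ← hrdef, this]
  rw [e]
  refine (measurableSet_setOfPred.1 (measurableSet_eq_fun ?_ measurable_const)).and
    ((measurableSet_setOfPred.1 (measurableSet_eq_fun (hit _) (hit _))).not.and
      (Measurable.exists fun a => (measurableSet_setOfPred.1 (measurableSet_eq_fun
        (measurable_iterate_step (measurable_eval a) (fun ω => ⟨a, rfl⟩) hr i) (hit _))).and
          (Measurable.forall fun c => Measurable.not ?_)))
  · exact (Finset.measurable_sum _ fun k _ => hcd k (k + 1)).add (hcd q 0)
  · have h1 := measurable_cdist (measurable_eval a) (measurable_eval c)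
    exact (measurableSet_setOfPred.1 (measurableSet_lt measurable_const h1)).and
      (measurableSet_setOfPred.1 (measurableSet_lt h1 (measurable_cdist (measurable_eval a) hf)))

theorem measurable_isOfType (hf : Measurable f) (hmem : ∀ ω, f ω ∈ Set.range ω) {p q : ℕ}
    (hp : 0 < p) (hpq : p ≤ q) (i : ℕ) :
    Measurable fun ω => IsOfType (Set.range ω) p q i (f ω) := by
  have hr := ratio_pos hp hpq
  have hex : ∀ j, Measurable fun ω => ∃ y, IsSwift (Set.range ω) p q j y ∧
      (step (Set.range ω) ((p : ℝ) / q))^[q + j] y = f ω := by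
    intro j
    have e : (fun ω => ∃ y, IsSwift (Set.range ω) p q j y ∧
        (step (Set.range ω) ((p : ℝ) / q))^[q + j] y = f ω) = fun ω => ∃ a : Fin n,
        IsSwift (Set.range ω) p q j (ω a) ∧
        (step (Set.range ω) ((p : ℝ) / q))^[q + j] (ω a) = f ω := by
      ext ω
      constructor
      · rintro ⟨y, hy, hy2⟩
        obtain ⟨a, rfl⟩ := hy.1
        exact ⟨a, hy, hy2⟩
      · rintro ⟨a, ha⟩
        exact ⟨_, ha⟩
    rw [e]
    exact Measurable.exists fun a =>
      (measurable_isSwift (measurable_eval a) (fun ω => ⟨a, rfl⟩) hp hpq j).and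
        (measurableSet_setOfPred.1 (measurableSet_eq_fun (measurable_iterate_step
          (measurable_eval a) (fun ω => ⟨a, rfl⟩) hr _) hf))
  have hper : Measurable fun ω => IsPeriodic (Set.range ω) ((p : ℝ) / q) (f ω) := by
    have e : (fun ω => IsPeriodic (Set.range ω) ((p : ℝ) / q) (f ω)) = fun ω =>
        ∃ k : ℕ, 1 ≤ k ∧ (step (Set.range ω) ((p : ℝ) / q))^[k] (f ω) = f ω := by
      ext ω
      have : ∃ y, ω y = f ω := hmem ω
      simp [IsPeriodic, this]
    rw [e]
    exact Measurable.exists fun k => measurable_const.and (measurableSet_setOfPred.1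
      (measurableSet_eq_fun (measurable_iterate_step hf hmem hr k) hf))
  exact hper.and ((hex i).and (Measurable.forall fun j => (hex j).imp measurable_const))

-- Coinciding sample points must be counted once, so each point is charged to the first index at
-- which it occurs.
open Classical in
theorem swi_eq_sum (ω : Fin n → Circ) (p q i : ℕ) :
    swi (Set.range ω) p q i = ∑ k : Fin n,
      if IsOfType (Set.range ω) p q i (ω k) ∧ ∀ j < k, ω j ≠ ω k then 1 else 0 := by
  rw [← Finset.card_filter, ← Set.ncard_coe_finset, ← Set.InjOn.ncard_image (f := ω)]
  · rw [swi]
    congr 1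
    ext x
    simp only [Set.mem_ofPred_eq, Set.mem_image, Finset.coe_filter, Finset.mem_univ, true_and]
    constructor
    · intro hx
      have hex : ∃ k : Fin n, ω k = x := hx.1.1
      obtain ⟨k, hk, hmin⟩ := WellFounded.has_min (wellFounded_lt (α := Fin n)) {k | ω k = x} hex
      have hk' : ω k = x := hk
      exact ⟨k, ⟨hk'.symm ▸ hx, fun j hj he => hmin j (he.trans hk') hj⟩, hk'⟩
    · rintro ⟨k, ⟨hk, -⟩, rfl⟩
      exact hk
  · intro a ha b hb hab
    simp only [Finset.coe_filter, Finset.mem_univ, true_and, Set.mem_ofPred_eq] at ha hb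
    rcases lt_trichotomy a b with h | h | h
    · exact absurd hab (hb.2 a h)
    · exact h
    · exact absurd hab.symm (ha.2 b h)

theorem measurable_swi {p q : ℕ} (hp : 0 < p) (hpq : p ≤ q) (i : ℕ) :
    Measurable fun ω : Fin n → Circ => (swi (Set.range ω) p q i : ℝ) := by
  classical
  simp only [swi_eq_sum, Nat.cast_sum, Nat.cast_ite, Nat.cast_one, Nat.cast_zero]
  refine Finset.measurable_sum _ fun k _ => Measurable.ite (measurableSet_setOfPred.2 ?_)
    measurable_const measurable_const
  exact (measurable_isOfType (measurable_eval k) (fun ω => ⟨k, rfl⟩) hp hpq i).and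
    (Measurable.forall fun j => measurable_const.imp (measurableSet_setOfPred.1
      (measurableSet_eq_fun (measurable_eval j) (measurable_eval k))).not)

theorem swi_le (ω : Fin n → Circ) (p q i : ℕ) : swi (Set.range ω) p q i ≤ n := by
  classical
  rw [swi_eq_sum]
  calc _ ≤ ∑ _k : Fin n, 1 := Finset.sum_le_sum fun k _ => by split_ifs <;> simp
    _ = n := by simp

theorem integrable_swi {p q : ℕ} (hp : 0 < p) (hpq : p ≤ q) (i : ℕ) :
    Integrable (fun ω : Fin n → Circ => (swi (Set.range ω) p q i : ℝ)) (sampleLaw n) := by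
  refine Integrable.of_bound (measurable_swi hp hpq i).aestronglyMeasurable n
    (ae_of_all _ fun ω => ?_)
  rw [Real.norm_of_nonneg (by positivity)]
  exact_mod_cast swi_le ω p q i

end

/-! ### Gap arcs -/

/-- The partial sum of the first `k` entries. -/
def psum {m : ℕ} (f : Fin m → ℝ) (k : ℕ) : ℝ := ∑ l : Fin m with l.val < k, f l

theorem psum_zero {m : ℕ} (f : Fin m → ℝ) : psum f 0 = 0 := by simp [psum]

theorem psum_succ {m : ℕ} (f : Fin m → ℝ) (l : Fin m) : psum f (l + 1) = psum f l + f l := by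
  have : Finset.univ.filter (fun l' : Fin m => l'.val < l.val + 1)
      = insert l (Finset.univ.filter fun l' : Fin m => l'.val < l.val) := by
    ext l'
    simp only [Finset.mem_filter, Finset.mem_univ, true_and, Finset.mem_insert, Fin.ext_iff]
    omega
  rw [psum, this, Finset.sum_insert (by simp), add_comm, psum]

theorem psum_mono {m : ℕ} {f : Fin m → ℝ} (hf : ∀ l, 0 ≤ f l) {j k : ℕ} (h : j ≤ k) :
    psum f j ≤ psum f k := by
  refine Finset.sum_le_sum_of_subset_of_nonneg (fun l hl => ?_) fun l _ _ => hf l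
  simp only [Finset.mem_filter, Finset.mem_univ, true_and] at hl ⊢
  omega

theorem psum_nonneg {m : ℕ} {f : Fin m → ℝ} (hf : ∀ l, 0 ≤ f l) (k : ℕ) : 0 ≤ psum f k :=
  Finset.sum_nonneg fun l _ => hf l

theorem psum_le {m : ℕ} {f : Fin m → ℝ} (hf : ∀ l, 0 ≤ f l) (k : ℕ) : psum f k ≤ ∑ l, |f l| :=
  (Finset.sum_le_sum_of_subset_of_nonneg (Finset.filter_subset _ _) fun _ _ _ => hf _).trans
    (Finset.sum_le_sum fun _ _ => le_abs_self _)

/-- The origin of the `l`-th gap of the chain of points `p` which starts at `a`. -/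
def origin (r : ℝ) (a : Circ) {m : ℕ} (p : Fin m → Circ) (l : Fin m) : Circ :=
  if l.val = 0 then a else p ⟨l.val - 1, by omega⟩ - (r : Circ)

/-- The gaps of the chain of points `p` which starts at `a`. -/
def chain (r : ℝ) (a : Circ) {m : ℕ} (p : Fin m → Circ) (l : Fin m) : ℝ :=
  cdist (origin r a p l) (p l)

theorem origin_eq (r : ℝ) (a : Circ) {m : ℕ} (p : Fin m → Circ) (l : Fin m) :
    origin r a p l = a + ((psum (chain r a p) l - l * r : ℝ) : Circ) := by
  obtain ⟨l, hl⟩ := l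
  induction l with
  | zero => simp [origin, psum_zero]
  | succ l ih =>
    have h := psum_succ (chain r a p) ⟨l, by omega⟩
    have h2 : p ⟨l, by omega⟩ = origin r a p ⟨l, by omega⟩ + (chain r a p ⟨l, by omega⟩ : Circ) :=
      (add_coe_cdist _ _).symm
    simp only [origin, Nat.add_sub_cancel, Nat.succ_ne_zero, if_false]
    rw [h2, ih (by omega)]
    simp only at h ⊢
    rw [h]
    push_cast
    have : ((((l : ℝ) + 1) * r : ℝ) : Circ) = ((l * r : ℝ) : Circ) + (r : Circ) := by
      rw [← AddCircle.coe_add]; congr 1; ring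
    rw [AddCircle.coe_sub, AddCircle.coe_sub, this, AddCircle.coe_add]
    abel

/-- The points `y_0, …, y_{m-1}` (left summand) and `x_1, …, x_m` (right summand). -/
abbrev Tuple (m : ℕ) : Type := Fin m ⊕ Fin m → Circ

variable {m : ℕ}

/-- The origins of the gaps between the points of the tuple `P` as seen from `x₀`. -/
def origins (r : ℝ) (x₀ : Circ) (P : Tuple m) : Fin m ⊕ Fin m → Circ :=
  Sum.elim (origin r x₀ fun l => P (Sum.inl l))
    (origin r (x₀ - (r : Circ)) fun l => P (Sum.inr l))

/-- The gaps between the points of the tuple `P` as seen from `x₀`. -/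
def tupleGaps (r : ℝ) (x₀ : Circ) (P : Tuple m) : GapSpace m :=
  (chain r x₀ fun l => P (Sum.inl l), chain r (x₀ - (r : Circ)) fun l => P (Sum.inr l))

/-- The half-open arc that spans a gap of the tuple `P`. -/
def gapArc (r : ℝ) (x₀ : Circ) (P : Tuple m) (τ : Fin m ⊕ Fin m) : Set Circ :=
  {s | 0 < cdist (origins r x₀ P τ) s ∧ cdist (origins r x₀ P τ) s ≤ cdist (origins r x₀ P τ) (P τ)}

/-- Up to a rotation by a multiple of `r`, the arcs of a family lie end to end: the parameter `θ`
runs through consecutive intervals of partial sums. -/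
theorem mem_gapArc_inl {r : ℝ} {x₀ s : Circ} {P : Tuple m} {l : Fin m}
    (h : s ∈ gapArc r x₀ P (Sum.inl l)) :
    ∃ θ : ℝ, s = x₀ + ((θ - l * r : ℝ) : Circ) ∧ psum (tupleGaps r x₀ P).1 l < θ ∧
      θ ≤ psum (tupleGaps r x₀ P).1 (l + 1) := by
  obtain ⟨h0, h1⟩ := h
  simp only [origins, Sum.elim_inl] at h0 h1
  set o := origin r x₀ (fun l => P (Sum.inl l)) l with ho
  refine ⟨psum (tupleGaps r x₀ P).1 l + cdist o s, ?_, by linarith, ?_⟩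
  · have e : o = x₀ + ((psum (tupleGaps r x₀ P).1 l - l * r : ℝ) : Circ) := origin_eq r x₀ _ l
    have hs := (add_coe_cdist o s).symm
    generalize cdist o s = c at hs ⊢
    generalize psum (tupleGaps r x₀ P).1 l = w at e ⊢
    rw [hs, e, add_assoc, ← AddCircle.coe_add]
    congr 2
    ring
  · rw [psum_succ]
    have : (tupleGaps r x₀ P).1 l = cdist o (P (Sum.inl l)) := rfl
    linarith

/-- The `x`-chain starts at `x₀ - r`, so its rotation index is one larger than that of the `z`-arc
with the same number. -/
theorem mem_gapArc_inr {r : ℝ} {x₀ s : Circ} {P : Tuple m} {l : Fin m}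
    (h : s ∈ gapArc r x₀ P (Sum.inr l)) :
    ∃ θ : ℝ, s = x₀ + ((θ - (l + 1 : ℕ) * r : ℝ) : Circ) ∧ psum (tupleGaps r x₀ P).2 l < θ ∧
      θ ≤ psum (tupleGaps r x₀ P).2 (l + 1) := by
  obtain ⟨h0, h1⟩ := h
  simp only [origins, Sum.elim_inr] at h0 h1
  set o := origin r (x₀ - (r : Circ)) (fun l => P (Sum.inr l)) l with ho
  refine ⟨psum (tupleGaps r x₀ P).2 l + cdist o s, ?_, by linarith, ?_⟩
  · have e : o = x₀ - (r : Circ) + ((psum (tupleGaps r x₀ P).2 l - l * r : ℝ) : Circ) :=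
      origin_eq r (x₀ - (r : Circ)) _ l
    have hs := (add_coe_cdist o s).symm
    generalize cdist o s = c at hs ⊢
    generalize psum (tupleGaps r x₀ P).2 l = w at e ⊢
    rw [hs, e, sub_eq_add_neg x₀, ← AddCircle.coe_neg, add_assoc, add_assoc, ← AddCircle.coe_add,
      ← AddCircle.coe_add]
    congr 2
    push_cast; ring
  · rw [psum_succ]
    have : (tupleGaps r x₀ P).2 l = cdist o (P (Sum.inr l)) := rfl
    linarith

/-- Multiplying the difference of the two positions by `q` shows that `q * (θ' - θ)` is an integer;
it has absolute value less than `1`, hence vanishes, and coprimality gives the divisibility. -/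
theorem eq_of_add_coe_eq {p q : ℕ} (hq : 0 < q) (hcop : Nat.Coprime p q) {x₀ : Circ}
    {θ θ' : ℝ} (h0 : 0 ≤ θ) (h1 : θ < 1 / q) (h0' : 0 ≤ θ') (h1' : θ' < 1 / q) {k k' : ℕ}
    (h : x₀ + ((θ - k * ((p : ℝ) / q) : ℝ) : Circ) = x₀ + ((θ' - k' * ((p : ℝ) / q) : ℝ) : Circ)) :
    θ = θ' ∧ (q : ℤ) ∣ k - k' := by
  obtain ⟨n, hn⟩ := coe_eq_coe_iff.1 (add_left_cancel h)
  have hq' : (0 : ℝ) < q := by exact_mod_cast hq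
  have e : q * (θ' - θ) = ((q * n + (k' - k) * p : ℤ) : ℝ) := by
    push_cast
    have : θ' - θ = n + (k' - k) * ((p : ℝ) / q) := by linarith
    rw [this]; field_simp
  have a1 : q * (θ' - θ) < 1 := by
    have : θ' - θ < 1 / q := by linarith
    calc q * (θ' - θ) < q * (1 / q) := by gcongr
      _ = 1 := by field_simp
  have a2 : -1 < q * (θ' - θ) := by
    have : -(1 / (q : ℝ)) < θ' - θ := by linarith
    calc (-1 : ℝ) = q * (-(1 / q)) := by field_simp
      _ < q * (θ' - θ) := by gcongr
  rw [e] at a1 a2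
  have b1 : (q * n + (k' - k) * p : ℤ) < 1 := by exact_mod_cast a1
  have b2 : -1 < (q * n + (k' - k) * p : ℤ) := by exact_mod_cast a2
  have b3 : (q * n + (k' - k) * p : ℤ) = 0 := by omega
  constructor
  · rw [b3] at e
    have : θ' - θ = 0 := by
      rcases mul_eq_zero.1 (e.trans Int.cast_zero) with h | h
      · exact absurd h hq'.ne'
      · exact h
    linarith
  · have hc : IsCoprime (q : ℤ) (p : ℤ) := Nat.isCoprime_iff_coprime.2 hcop.symm
    exact hc.dvd_of_dvd_mul_right ⟨n, by linarith⟩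

theorem abs_sum_le_norm1 (u : GapSpace m) :
    ∑ l, |u.1 l| ≤ norm1 u ∧ ∑ l, |u.2 l| ≤ norm1 u := by
  have h1 : 0 ≤ ∑ l, |u.1 l| := Finset.sum_nonneg fun _ _ => abs_nonneg _
  have h2 : 0 ≤ ∑ l, |u.2 l| := Finset.sum_nonneg fun _ _ => abs_nonneg _
  constructor <;> simp only [norm1] <;> linarith

section

variable {p q i : ℕ} {x₀ : Circ} {P : Tuple (i + q - 1)}

/-- This is where the inequalities of the cone enter. A common point has the same `θ` in both
families, and `q` divides the difference `l + 1 - l'` of rotation indices. If this difference is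
positive, it is at least `q`, and a failing inequality `H (j) (j + q - 2)` puts the `z`-interval
below the `w`-interval. If it is at most `0`, a diagonal inequality puts the `w`-interval below the
`z`-interval. -/
theorem not_mem_gapArc_inl_inr (hq : 0 < q) (hcop : Nat.Coprime p q)
    (hS : tupleGaps ((p : ℝ) / q) x₀ P ∈ S q i)
    (hn : norm1 (tupleGaps ((p : ℝ) / q) x₀ P) < 1 / q) {s : Circ} {l l' : Fin (i + q - 1)}
    (h : s ∈ gapArc ((p : ℝ) / q) x₀ P (Sum.inl l')) :
    s ∉ gapArc ((p : ℝ) / q) x₀ P (Sum.inr l) := by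
  intro h'
  obtain ⟨θ', e', a', b'⟩ := mem_gapArc_inl h
  obtain ⟨θ, e, a, b⟩ := mem_gapArc_inr h'
  set u := tupleGaps ((p : ℝ) / q) x₀ P
  obtain ⟨hz, hw, hdiag, hnot, -⟩ := hS
  have hn1 := abs_sum_le_norm1 u
  have c1 := psum_le hz (l' + 1)
  have c2 := psum_le hw (l + 1)
  have c3 := psum_nonneg hz l'
  have c4 := psum_nonneg hw l
  obtain ⟨rfl, hdvd⟩ := eq_of_add_coe_eq hq hcop (by linarith) (by linarith) (by linarith)
    (by linarith) (e.symm.trans e')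
  rcases lt_or_ge l'.val (l.val + 1) with hl | hl
  · have hle : (q : ℤ) ≤ ((l.val + 1 : ℕ) : ℤ) - l' := Int.le_of_dvd (by push_cast; omega) hdvd
    -- The index is chosen so that the `w`-sum has exactly `l` terms; `q ≤ l + 1 - l'` gives `l' + 1
    -- ≤ l + 2 - q`.
    have h1 := hnot (l + 2 - q) (by omega) (by omega)
    have h2 : ¬ psum u.2 (l + 2 - q + q - 2) ≤ psum u.1 (l + 2 - q) := h1
    rw [show l.val + 2 - q + q - 2 = l by omega] at h2
    have h3 := psum_mono hz (show l'.val + 1 ≤ l + 2 - q by omega)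
    linarith
  · have h1 : psum u.2 (l + 1) ≤ psum u.1 (l + 1) := hdiag (l + 1) (by omega) (by omega)
    have h3 := psum_mono hz hl
    linarith

theorem gapArc_disjoint (hq : 0 < q) (hcop : Nat.Coprime p q)
    (hS : tupleGaps ((p : ℝ) / q) x₀ P ∈ S q i)
    (hn : norm1 (tupleGaps ((p : ℝ) / q) x₀ P) < 1 / q) {s : Circ}
    {τ τ' : Fin (i + q - 1) ⊕ Fin (i + q - 1)}
    (h : s ∈ gapArc ((p : ℝ) / q) x₀ P τ) (h' : s ∈ gapArc ((p : ℝ) / q) x₀ P τ') : τ = τ' := by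
  have hn1 := abs_sum_le_norm1 (tupleGaps ((p : ℝ) / q) x₀ P)
  rcases τ with l | l <;> rcases τ' with l' | l'
  · obtain ⟨θ, e, a, b⟩ := mem_gapArc_inl h
    obtain ⟨θ', e', a', b'⟩ := mem_gapArc_inl h'
    obtain ⟨hz, hw, -⟩ := hS
    have c1 := psum_le hz (l' + 1)
    have c2 := psum_le hz (l + 1)
    have c3 := psum_nonneg hz l'
    have c4 := psum_nonneg hz l
    obtain ⟨rfl, -⟩ := eq_of_add_coe_eq hq hcop (by linarith) (by linarith) (by linarith)
      (by linarith) (e.symm.trans e')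
    congr 1
    rcases lt_trichotomy l.val l'.val with hl | hl | hl
    · linarith [psum_mono hz (show l.val + 1 ≤ l' from hl)]
    · exact Fin.ext hl
    · linarith [psum_mono hz (show l'.val + 1 ≤ l from hl)]
  · exact absurd h' (not_mem_gapArc_inl_inr hq hcop hS hn h)
  · exact absurd h (not_mem_gapArc_inl_inr hq hcop hS hn h')
  · obtain ⟨θ, e, a, b⟩ := mem_gapArc_inr h
    obtain ⟨θ', e', a', b'⟩ := mem_gapArc_inr h'
    obtain ⟨hz, hw, -⟩ := hS
    have c1 := psum_le hw (l' + 1)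
    have c2 := psum_le hw (l + 1)
    have c3 := psum_nonneg hw l'
    have c4 := psum_nonneg hw l
    obtain ⟨rfl, -⟩ := eq_of_add_coe_eq hq hcop (by linarith) (by linarith) (by linarith)
      (by linarith) (e.symm.trans e')
    congr 1
    rcases lt_trichotomy l.val l'.val with hl | hl | hl
    · linarith [psum_mono hw (show l.val + 1 ≤ l' from hl)]
    · exact Fin.ext hl
    · linarith [psum_mono hw (show l'.val + 1 ≤ l from hl)]

/-- The base point has parameter `θ = 0`, whereas points of gap arcs have positive parameter. -/
theorem base_not_mem_gapArc (hq : 0 < q) (hcop : Nat.Coprime p q)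
    (hS : tupleGaps ((p : ℝ) / q) x₀ P ∈ S q i)
    (hn : norm1 (tupleGaps ((p : ℝ) / q) x₀ P) < 1 / q)
    (τ : Fin (i + q - 1) ⊕ Fin (i + q - 1)) : x₀ ∉ gapArc ((p : ℝ) / q) x₀ P τ := by
  intro h
  have hn1 := abs_sum_le_norm1 (tupleGaps ((p : ℝ) / q) x₀ P)
  have hq' : (0 : ℝ) < 1 / q := by positivity
  have e0 : x₀ = x₀ + ((0 - (0 : ℕ) * ((p : ℝ) / q) : ℝ) : Circ) := by simp
  obtain ⟨hz, hw, -⟩ := hS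
  rcases τ with l | l
  · obtain ⟨θ, e, a, b⟩ := mem_gapArc_inl h
    have c2 := psum_le hz (l + 1)
    have c4 := psum_nonneg hz l
    obtain ⟨rfl, -⟩ := eq_of_add_coe_eq hq hcop le_rfl hq' (by linarith) (by linarith)
      (e0.symm.trans e)
    linarith
  · obtain ⟨θ, e, a, b⟩ := mem_gapArc_inr h
    have c2 := psum_le hw (l + 1)
    have c4 := psum_nonneg hw l
    obtain ⟨rfl, -⟩ := eq_of_add_coe_eq hq hcop le_rfl hq' (by linarith) (by linarith)
      (e0.symm.trans e)
    linarith

end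

/-- The tuple of the points `y_0, …, y_{m-1}, x_1, …, x_m` of `X` seen from `x₀`. -/
def backTuple (m : ℕ) (X : Set Circ) (r : ℝ) (x₀ : Circ) : Tuple m :=
  Sum.elim (fun l => ys X r x₀ l) (fun l => xs X r x₀ (l + 1))

theorem origins_backTuple (X : Set Circ) (r : ℝ) (x₀ : Circ) (τ : Fin m ⊕ Fin m) :
    next X (origins r x₀ (backTuple m X r x₀) τ) = backTuple m X r x₀ τ := by
  rcases τ with ⟨l, hl⟩ | ⟨l, hl⟩ <;> cases l <;> rfl

theorem tupleGaps_backTuple (X : Set Circ) (r : ℝ) (x₀ : Circ) :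
    tupleGaps r x₀ (backTuple m X r x₀) = gaps m X r x₀ := by
  refine Prod.ext (funext fun l => ?_) (funext fun l => ?_) <;>
  · rcases l with ⟨l, hl⟩
    cases l <;> rfl

/-- A tuple of points of `X` whose gap arcs are nondegenerate and contain no further points of `X`
is the tuple of points seen from `x₀`. -/
theorem eq_backTuple {X : Set Circ} {r : ℝ} {x₀ : Circ} {P : Tuple m} (hP : ∀ τ, P τ ∈ X)
    (hne : ∀ τ, 0 < cdist (origins r x₀ P τ) (P τ))
    (harc : ∀ s ∈ X, ∀ τ, s ∈ gapArc r x₀ P τ → s = P τ) : P = backTuple m X r x₀ := by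
  have hnext : ∀ τ, next X (origins r x₀ P τ) = P τ := by
    intro τ
    refine IsNext.next_eq ⟨hP τ, cdist_pos_iff.1 (hne τ), fun t ht hto => ?_⟩
    by_contra! hlt
    have := harc t ht τ ⟨cdist_pos_iff.2 hto, hlt.le⟩
    rw [this] at hlt
    exact lt_irrefl _ hlt
  funext τ
  rcases τ with ⟨l, hl⟩ | ⟨l, hl⟩
  · induction l with
    | zero => exact (hnext (Sum.inl ⟨0, hl⟩)).symm
    | succ l ih =>
      rw [← hnext, ← origins_backTuple]
      congr 1
      have := ih (by omega)
      simp only [origins, origin, Sum.elim_inl, Nat.succ_ne_zero, if_false, Nat.add_sub_cancel, this]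
  · induction l with
    | zero => exact (hnext (Sum.inr ⟨0, hl⟩)).symm
    | succ l ih =>
      rw [← hnext, ← origins_backTuple]
      congr 1
      have := ih (by omega)
      simp only [origins, origin, Sum.elim_inr, Nat.succ_ne_zero, if_false, Nat.add_sub_cancel, this]

/-! ### The law of the gaps -/

/-- Fubini's theorem for independent points: if the points indexed by the range of `σ` are fixed,
the others remain independent. -/
theorem measure_pi_embedding {α ι κ : Type*} [MeasurableSpace α] [Fintype ι] [Fintype κ]
    (μ : Measure α) [IsProbabilityMeasure μ] (σ : ι ↪ κ) {A : Set (ι → α)} (hA : MeasurableSet A)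
    {R : Set ((ι → α) × α)} (hR : MeasurableSet R) :
    Measure.pi (fun _ : κ => μ) {ω | (fun a => ω (σ a)) ∈ A ∧
      ∀ k ∉ Set.range σ, ((fun a => ω (σ a)), ω k) ∈ R} =
    ∫⁻ p in A, μ {t | (p, t) ∈ R} ^ (Fintype.card κ - Fintype.card ι)
      ∂(Measure.pi fun _ : ι => μ) := by
  classical
  set e : ι ⊕ {k // ¬ k ∈ Set.range σ} ≃ κ :=
    (Equiv.sumCongr (Equiv.ofInjective σ σ.injective) (Equiv.refl _)).trans
      (Equiv.sumCompl (· ∈ Set.range σ)) with he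
  have e1 : ∀ a, e (Sum.inl a) = σ a := fun a => rfl
  have e2 : ∀ k, e (Sum.inr k) = k.1 := fun k => rfl
  have h1 := measurePreserving_piCongrLeft (fun _ : κ => μ) e
  have h2 := (measurePreserving_sumPiEquivProdPi
    (fun _ : ι ⊕ {k // ¬ k ∈ Set.range σ} => μ)).symm
  have h3 := h1.comp h2
  have hE : MeasurableSet {ω : κ → α | (fun a => ω (σ a)) ∈ A ∧
      ∀ k ∉ Set.range σ, ((fun a => ω (σ a)), ω k) ∈ R} := by
    have hσ : Measurable fun ω : κ → α => fun a => ω (σ a) :=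
      measurable_pi_lambda _ fun a => measurable_pi_apply _
    exact measurableSet_setOfPred.2 ((measurableSet_setOfPred.1 (hσ hA)).and
      (Measurable.forall fun k => measurable_const.imp (measurableSet_setOfPred.1
        ((hσ.prodMk (measurable_pi_apply k)) hR))))
  rw [← h3.measure_preimage hE.nullMeasurableSet, Measure.prod_apply (h3.measurable hE),
    ← lintegral_indicator hA]
  refine lintegral_congr fun p => ?_
  have key : ∀ c : {k // ¬ k ∈ Set.range σ} → α,
      (∀ a, MeasurableEquiv.piCongrLeft (fun _ : κ => α) e
        ((MeasurableEquiv.sumPiEquivProdPi fun _ => α).symm (p, c)) (σ a) = p a) ∧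
      (∀ k, MeasurableEquiv.piCongrLeft (fun _ : κ => α) e
        ((MeasurableEquiv.sumPiEquivProdPi fun _ => α).symm (p, c)) k.1 = c k) := by
    intro c
    constructor
    · intro a
      rw [← e1]
      exact Equiv.piCongrLeft_apply_apply (fun _ : κ => α) e _ _
    · intro k
      rw [← e2]
      exact Equiv.piCongrLeft_apply_apply (fun _ : κ => α) e _ _
  by_cases hp : p ∈ A
  · rw [Set.indicator_of_mem hp]
    have : Prod.mk p ⁻¹' (((MeasurableEquiv.piCongrLeft (fun _ : κ => α) e) ∘
        (MeasurableEquiv.sumPiEquivProdPi fun _ => α).symm) ⁻¹'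
          {ω : κ → α | (fun a => ω (σ a)) ∈ A ∧
            ∀ k ∉ Set.range σ, ((fun a => ω (σ a)), ω k) ∈ R}) =
        Set.univ.pi fun _ => {t | (p, t) ∈ R} := by
      ext c
      simp only [Set.mem_preimage, Function.comp_apply, Set.mem_ofPred_eq, (key c).1, hp, true_and,
        Set.mem_pi, Set.mem_univ, true_imp_iff]
      constructor
      · intro h k
        rw [← (key c).2 k]; exact h k.1 k.2
      · intro h k hk
        have := (key c).2 ⟨k, hk⟩
        simp only at this
        rw [this]; exact h ⟨k, hk⟩
    rw [this, Measure.pi_pi, Finset.prod_const, Finset.card_univ]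
    congr 1
    rw [Fintype.card_subtype_compl]
    congr 1
    exact (Fintype.card_congr (Equiv.ofInjective σ σ.injective)).symm
  · rw [Set.indicator_of_notMem hp]
    convert measure_empty (μ := Measure.pi fun _ : {k // ¬ k ∈ Set.range σ} => μ)
    ext c
    simp only [Set.mem_preimage, Function.comp_apply, Set.mem_ofPred_eq, (key c).1, hp, false_and,
      Set.mem_empty_iff_false]

/-- The homomorphism that sends a sequence to its successive differences. -/
def diffHom (m : ℕ) : (Fin m → Circ) →+ (Fin m → Circ) where
  toFun p l := p l - if l.val = 0 then 0 else p ⟨l.val - 1, by omega⟩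
  map_zero' := by ext l; simp
  map_add' p p' := by
    ext l
    simp only [Pi.add_apply]
    split_ifs
    · abel
    · abel

theorem diffHom_surjective (m : ℕ) : Function.Surjective (diffHom m) := by
  intro d
  set d' : ℕ → Circ := fun j => if h : j < m then d ⟨j, h⟩ else 0 with hd'
  refine ⟨fun l => ∑ j ∈ Finset.range (l + 1), d' j, ?_⟩
  ext ⟨l, hl⟩
  show (∑ j ∈ Finset.range (l + 1), d' j) - (if l = 0 then 0 else
    ∑ j ∈ Finset.range (l - 1 + 1), d' j) = d ⟨l, hl⟩
  have : d' l = d ⟨l, hl⟩ := by simp [hd', hl]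
  rw [← this]
  cases l with
  | zero => simp
  | succ l =>
    rw [if_neg (Nat.succ_ne_zero l), Nat.add_sub_cancel, Finset.sum_range_succ]
    abel

theorem continuous_diffHom (m : ℕ) : Continuous (diffHom m) := by
  refine continuous_pi fun l => ?_
  show Continuous fun p : Fin m → Circ => p l - if l.val = 0 then 0 else p ⟨l.val - 1, by omega⟩
  split_ifs <;> fun_prop

theorem measurePreserving_diffHom (m : ℕ) : MeasurePreserving (diffHom m) volume volume :=
  AddMonoidHom.measurePreserving (continuous_diffHom m) (diffHom_surjective m) rfl

/-- Taking successive differences is a continuous surjective homomorphism of a compact group, so it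
preserves Haar measure; a translation and the coordinatewise distance from `0` then produce the
gaps. -/
theorem measurePreserving_chain (r : ℝ) (a : Circ) (m : ℕ) :
    MeasurePreserving (chain r a : (Fin m → Circ) → Fin m → ℝ) volume
      (Measure.pi fun _ => (volume : Measure ℝ).restrict (Set.Ico 0 1)) := by
  have h1 := measurePreserving_diffHom m
  have h2 := measurePreserving_add_right (volume : Measure (Fin m → Circ))
    (fun l => if l.val = 0 then -a else (r : Circ))
  have h3 : MeasurePreserving (fun (p : Fin m → Circ) l => cdist 0 (p l)) volume
      (Measure.pi fun _ => (volume : Measure ℝ).restrict (Set.Ico 0 1)) :=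
    measurePreserving_pi _ _ fun _ => measurePreserving_cdist_zero
  have h4 := h3.comp (h2.comp h1)
  convert! h4 using 1
  ext p l
  rw [chain, cdist_eq_cdist_zero]
  show _ = cdist 0 ((p l - if l.val = 0 then 0 else p ⟨l.val - 1, by omega⟩) +
    if l.val = 0 then -a else (r : Circ))
  congr 1
  rw [origin]
  split_ifs <;> abel

/-- The box `[0, 1)^{2m}`. -/
def unitBox (m : ℕ) : Set (GapSpace m) :=
  (Set.univ.pi fun _ => Set.Ico 0 1) ×ˢ (Set.univ.pi fun _ => Set.Ico 0 1)

theorem measurePreserving_tupleGaps (r : ℝ) (x₀ : Circ) :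
    MeasurePreserving (tupleGaps r x₀ : Tuple m → GapSpace m) volume
      (volume.restrict (unitBox m)) := by
  have h1 := measurePreserving_sumPiEquivProdPi
    (fun _ : Fin m ⊕ Fin m => (volume : Measure Circ))
  have h2 := (measurePreserving_chain r x₀ m).prod (measurePreserving_chain r (x₀ - (r : Circ)) m)
  have e : (volume.restrict (unitBox m) : Measure (GapSpace m)) =
      (Measure.pi fun _ => (volume : Measure ℝ).restrict (Set.Ico 0 1)).prod
      (Measure.pi fun _ => (volume : Measure ℝ).restrict (Set.Ico 0 1)) := by
    rw [← Measure.restrict_pi_pi, Measure.prod_restrict]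
    rfl
  rw [e]
  exact h2.comp h1

theorem measurable_norm1 (m : ℕ) : Measurable (norm1 : GapSpace m → ℝ) :=
  (Finset.measurable_sum _ fun l _ => ((measurable_pi_apply l).comp measurable_fst).abs).add
    (Finset.measurable_sum _ fun l _ => ((measurable_pi_apply l).comp measurable_snd).abs)

/-- The part of the interior of the cone `S q i` where the gaps are too short to overlap. -/
def smallCone (q i : ℕ) : Set (GapSpace (i + q - 1)) :=
  {u | u ∈ S q i ∧ (∀ l, 0 < u.1 l) ∧ (∀ l, 0 < u.2 l) ∧ norm1 u < 1 / q}

theorem measurableSet_smallCone (q i : ℕ) : MeasurableSet (smallCone q i) := by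
  have h1 : ∀ l, Measurable fun u : GapSpace (i + q - 1) => 0 < u.1 l := fun l =>
    measurableSet_setOfPred.1 (measurableSet_lt measurable_const
      ((measurable_pi_apply l).comp measurable_fst))
  have h2 : ∀ l, Measurable fun u : GapSpace (i + q - 1) => 0 < u.2 l := fun l =>
    measurableSet_setOfPred.1 (measurableSet_lt measurable_const
      ((measurable_pi_apply l).comp measurable_snd))
  exact measurableSet_setOfPred.2 ((measurableSet_setOfPred.1 (measurableSet_S q i)).and
    ((Measurable.forall h1).and ((Measurable.forall h2).and
      (measurableSet_setOfPred.1 (measurableSet_lt (measurable_norm1 _) measurable_const)))))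

theorem smallCone_subset_unitBox {q i : ℕ} (hq : 0 < q) :
    smallCone q i ⊆ unitBox (i + q - 1) := by
  rintro u ⟨-, h1, h2, h3⟩
  have hn := abs_sum_le_norm1 u
  have hq1 : (1 : ℝ) / q ≤ 1 := by
    rw [div_le_one (by exact_mod_cast hq)]; exact_mod_cast hq
  refine ⟨fun l _ => ⟨(h1 l).le, ?_⟩, fun l _ => ⟨(h2 l).le, ?_⟩⟩
  · have := Finset.single_le_sum (f := fun l => |u.1 l|) (fun l _ => abs_nonneg _)
      (Finset.mem_univ l)
    linarith [le_abs_self (u.1 l)]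
  · have := Finset.single_le_sum (f := fun l => |u.2 l|) (fun l _ => abs_nonneg _)
      (Finset.mem_univ l)
    linarith [le_abs_self (u.2 l)]

theorem measurable_origins (r : ℝ) (x₀ : Circ) (τ : Fin m ⊕ Fin m) :
    Measurable fun P : Tuple m => origins r x₀ P τ := by
  rcases τ with l | l
  · simp only [origins, Sum.elim_inl, origin]
    split_ifs
    · exact measurable_const
    · exact (measurable_pi_apply _).sub measurable_const
  · simp only [origins, Sum.elim_inr, origin]
    split_ifs
    · exact measurable_const
    · exact (measurable_pi_apply _).sub measurable_const

theorem measurableSet_gapArc (r : ℝ) (x₀ : Circ) (P : Tuple m) (τ : Fin m ⊕ Fin m) :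
    MeasurableSet (gapArc r x₀ P τ) := by
  have h := (measurePreserving_cdist (origins r x₀ P τ)).measurable
  exact measurableSet_setOfPred.2 ((measurableSet_setOfPred.1 (measurableSet_lt
    measurable_const h)).and (measurableSet_setOfPred.1 (measurableSet_le h measurable_const)))

theorem volume_gapArc (r : ℝ) (x₀ : Circ) (P : Tuple m) (τ : Fin m ⊕ Fin m) :
    volume (gapArc r x₀ P τ) = ENNReal.ofReal (cdist (origins r x₀ P τ) (P τ)) := by
  have h := (measurePreserving_cdist (origins r x₀ P τ)).measure_preimage
    (s := Set.Ioc 0 (cdist (origins r x₀ P τ) (P τ))) measurableSet_Ioc.nullMeasurableSet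
  have e : gapArc r x₀ P τ = cdist (origins r x₀ P τ) ⁻¹'
    Set.Ioc 0 (cdist (origins r x₀ P τ) (P τ)) := rfl
  rw [e, h, Measure.restrict_apply measurableSet_Ioc, Set.inter_eq_left.2, Real.volume_Ioc,
    sub_zero]
  intro c hc
  exact ⟨hc.1.le, hc.2.trans_lt (cdist_lt_one _ _)⟩

theorem norm1_tupleGaps (r : ℝ) (x₀ : Circ) (P : Tuple m) :
    norm1 (tupleGaps r x₀ P) = ∑ τ, cdist (origins r x₀ P τ) (P τ) := by
  rw [Fintype.sum_sum_type, norm1]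
  congr 1 <;> exact Finset.sum_congr rfl fun l _ => abs_of_nonneg (cdist_nonneg _ _)

/-! ### The exact probability of seeing short gaps in the cone -/

section

variable {p q i : ℕ}

theorem volume_avoid_gapArcs (hq : 0 < q) (hcop : Nat.Coprime p q) {x₀ : Circ}
    {P : Tuple (i + q - 1)} (hP : tupleGaps ((p : ℝ) / q) x₀ P ∈ smallCone q i) :
    volume {t | ∀ τ, t ∉ gapArc ((p : ℝ) / q) x₀ P τ} =
      ENNReal.ofReal (1 - norm1 (tupleGaps ((p : ℝ) / q) x₀ P)) := by
  obtain ⟨hS, -, -, hn⟩ := hP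
  have e : {t | ∀ τ, t ∉ gapArc ((p : ℝ) / q) x₀ P τ} = (⋃ τ, gapArc ((p : ℝ) / q) x₀ P τ)ᶜ := by
    ext t; simp
  have hd : Pairwise (Function.onFun Disjoint fun τ => gapArc ((p : ℝ) / q) x₀ P τ) := by
    intro τ τ' hne
    rw [Function.onFun, Set.disjoint_left]
    intro s hs hs'
    exact hne (gapArc_disjoint hq hcop hS hn hs hs')
  rw [e, prob_compl_eq_one_sub (MeasurableSet.iUnion fun τ => measurableSet_gapArc _ _ _ _),
    measure_iUnion hd (fun τ => measurableSet_gapArc _ _ _ _), tsum_fintype, norm1_tupleGaps,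
    ENNReal.ofReal_sub _ (Finset.sum_nonneg fun τ _ => cdist_nonneg _ _), ENNReal.ofReal_one,
    ENNReal.ofReal_sum_of_nonneg fun τ _ => cdist_nonneg _ _]
  simp only [volume_gapArc]

/-- The event that the points with indices in the range of `σ` are the points seen from `x₀`. -/
def tupleEvent (p q i : ℕ) (x₀ : Circ) {N : ℕ} (σ : Fin (i + q - 1) ⊕ Fin (i + q - 1) ↪ Fin N) :
    Set (Fin N → Circ) :=
  {ω | (fun a => ω (σ a)) ∈ tupleGaps ((p : ℝ) / q) x₀ ⁻¹' smallCone q i ∧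
    ∀ k ∉ Set.range σ, ((fun a => ω (σ a)), ω k) ∈
      {z : Tuple (i + q - 1) × Circ | ∀ τ, z.2 ∉ gapArc ((p : ℝ) / q) x₀ z.1 τ}}

theorem measurableSet_avoid (r : ℝ) (x₀ : Circ) :
    MeasurableSet {z : Tuple m × Circ | ∀ τ, z.2 ∉ gapArc r x₀ z.1 τ} := by
  refine measurableSet_setOfPred.2 (Measurable.forall fun τ => Measurable.not ?_)
  have h0 : Measurable fun z : Tuple m × Circ => origins r x₀ z.1 τ :=
    (measurable_origins r x₀ τ).comp measurable_fst
  have h1 := measurable_cdist h0 measurable_snd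
  have h2 := measurable_cdist h0 ((measurable_pi_apply τ).comp measurable_fst)
  exact (measurableSet_setOfPred.1 (measurableSet_lt measurable_const h1)).and
    (measurableSet_setOfPred.1 (measurableSet_le h1 h2))

theorem measurableSet_tupleEvent (x₀ : Circ) {N : ℕ}
    (σ : Fin (i + q - 1) ⊕ Fin (i + q - 1) ↪ Fin N) : MeasurableSet (tupleEvent p q i x₀ σ) := by
  have hσ : Measurable fun ω : Fin N → Circ => fun a => ω (σ a) :=
    measurable_pi_lambda _ fun a => measurable_pi_apply _
  have hA : MeasurableSet (tupleGaps ((p : ℝ) / q) x₀ ⁻¹' smallCone q i) :=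
    (measurePreserving_tupleGaps _ x₀).measurable (measurableSet_smallCone q i)
  exact measurableSet_setOfPred.2 ((measurableSet_setOfPred.1 (hσ hA)).and
    (Measurable.forall fun k => measurable_const.imp (measurableSet_setOfPred.1
      ((hσ.prodMk (measurable_pi_apply k)) (measurableSet_avoid _ x₀)))))

theorem measure_tupleEvent (hq : 0 < q) (hcop : Nat.Coprime p q) (x₀ : Circ) {N : ℕ}
    (σ : Fin (i + q - 1) ⊕ Fin (i + q - 1) ↪ Fin N) :
    sampleLaw N (tupleEvent p q i x₀ σ) =
      ∫⁻ u in smallCone q i,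
        ENNReal.ofReal (1 - norm1 u) ^ (N - ((i + q - 1) + (i + q - 1))) := by
  have hT := measurableSet_smallCone q i
  have hU := measurePreserving_tupleGaps (m := i + q - 1) ((p : ℝ) / q) x₀
  have h := measure_pi_embedding (volume : Measure Circ) σ (hU.measurable hT)
    (measurableSet_avoid ((p : ℝ) / q) x₀)
  rw [sampleLaw, tupleEvent, h]
  simp only [Fintype.card_fin, Fintype.card_sum]
  rw [setLIntegral_congr_fun (hU.measurable hT)
    (g := fun P => ENNReal.ofReal (1 - norm1 (tupleGaps ((p : ℝ) / q) x₀ P)) ^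
      (N - ((i + q - 1) + (i + q - 1))))]
  · have := hU.setLIntegral_comp_preimage hT (f := fun u => ENNReal.ofReal (1 - norm1 u) ^
      (N - ((i + q - 1) + (i + q - 1)))) (((measurable_const.sub
        (measurable_norm1 _)).ennreal_ofReal).pow_const _)
    rw [Measure.restrict_restrict hT,
      Set.inter_eq_left.2 (smallCone_subset_unitBox hq)] at this
    exact this
  · intro P hP
    simp only
    rw [← volume_avoid_gapArcs hq hcop hP]
    rfl

theorem origins_pos_of_smallCone {x₀ : Circ} {P : Tuple (i + q - 1)}
    (hP : tupleGaps ((p : ℝ) / q) x₀ P ∈ smallCone q i) (τ : Fin (i + q - 1) ⊕ Fin (i + q - 1)) :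
    0 < cdist (origins ((p : ℝ) / q) x₀ P τ) (P τ) := by
  rcases τ with l | l
  · exact hP.2.1 l
  · exact hP.2.2.1 l

/-- For generic `ω` the points indexed by `σ` are those seen from `x₀`. -/
theorem eq_backTuple_of_mem_tupleEvent (hq : 0 < q) (hcop : Nat.Coprime p q) {x₀ : Circ} {N : ℕ}
    {σ : Fin (i + q - 1) ⊕ Fin (i + q - 1) ↪ Fin N} {ω : Fin N → Circ}
    (h : ω ∈ tupleEvent p q i x₀ σ) :
    (fun a => ω (σ a)) =
      backTuple (i + q - 1) (insert x₀ (Set.range ω)) ((p : ℝ) / q) x₀ := by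
  obtain ⟨hU, hrest⟩ := h
  have hU' : tupleGaps ((p : ℝ) / q) x₀ (fun a => ω (σ a)) ∈ smallCone q i := hU
  have hpos := origins_pos_of_smallCone hU'
  refine eq_backTuple (fun τ => Or.inr ⟨σ τ, rfl⟩) hpos ?_
  rintro s (rfl | ⟨k, rfl⟩) τ hs
  · exact absurd hs (base_not_mem_gapArc hq hcop hU'.1 hU'.2.2.2 τ)
  · by_cases hk : k ∈ Set.range σ
    · obtain ⟨τ', rfl⟩ := hk
      rw [gapArc_disjoint hq hcop hU'.1 hU'.2.2.2 hs ⟨hpos τ', le_rfl⟩]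
    · exact absurd hs (hrest k hk τ)

/-- Disjointness of the gap arcs makes the points seen from `x₀` pairwise distinct and different
from `x₀`, so they define an embedding of indices. By minimality of successors, no other sample
point lies in an arc. -/
theorem gaps_mem_smallCone_iff (hq : 0 < q) (hcop : Nat.Coprime p q) {x₀ : Circ} {N : ℕ}
    (hN : 0 < N) {ω : Fin N → Circ} (hx₀ : ∀ k, ω k ≠ x₀) (hinj : Function.Injective ω) :
    gaps (i + q - 1) (insert x₀ (Set.range ω)) ((p : ℝ) / q) x₀ ∈ smallCone q i ↔
      ∃ σ, ω ∈ tupleEvent p q i x₀ σ := by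
  set X := insert x₀ (Set.range ω) with hX
  have hfin : X.Finite := (Set.finite_range ω).insert x₀
  have hne : ∀ a, ∃ t ∈ X, t ≠ a := by
    intro a
    by_cases ha : x₀ = a
    · exact ⟨ω ⟨0, hN⟩, Or.inr ⟨_, rfl⟩, ha ▸ hx₀ _⟩
    · exact ⟨x₀, Or.inl rfl, ha⟩
  constructor
  · intro h
    set P := backTuple (i + q - 1) X ((p : ℝ) / q) x₀ with hPdef
    rw [← tupleGaps_backTuple, ← hPdef] at h
    have hpos := origins_pos_of_smallCone h
    have hnext : ∀ τ, IsNext X (origins ((p : ℝ) / q) x₀ P τ) (P τ) := by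
      intro τ
      have := next_spec hfin (hne (origins ((p : ℝ) / q) x₀ P τ))
      rwa [origins_backTuple] at this
    have hmem : ∀ τ, P τ ∈ gapArc ((p : ℝ) / q) x₀ P τ := fun τ => ⟨hpos τ, le_rfl⟩
    have hrange : ∀ τ, ∃ k, ω k = P τ := by
      intro τ
      rcases (hnext τ).1 with h0 | h0
      · have := base_not_mem_gapArc hq hcop h.1 h.2.2.2 τ
        rw [← h0] at this
        exact absurd (hmem τ) (h0 ▸ this)
      · exact h0
    choose σ hσ using hrange
    have hσinj : Function.Injective σ := by
      intro τ τ' e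
      refine gapArc_disjoint hq hcop h.1 h.2.2.2 (hmem τ) ?_
      rw [← hσ τ, e, hσ τ']
      exact hmem τ'
    have hP : (fun a => ω (σ a)) = P := funext hσ
    refine ⟨⟨σ, hσinj⟩, ?_, ?_⟩
    · show tupleGaps ((p : ℝ) / q) x₀ (fun a => ω (σ a)) ∈ smallCone q i
      rw [hP]; exact h
    · intro k hk τ hτ
      simp only [Function.Embedding.coeFn_mk, hP] at hτ hk
      apply hk
      refine ⟨τ, hinj ?_⟩
      rw [hσ τ]
      refine cdist_inj (le_antisymm ((hnext τ).2.2 _ (Or.inr ⟨k, rfl⟩) (cdist_pos_iff.1 hτ.1)) hτ.2)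
  · rintro ⟨σ, hσ⟩
    rw [← tupleGaps_backTuple, hX, ← eq_backTuple_of_mem_tupleEvent hq hcop hσ]
    exact hσ.1

/-- The difference of two coordinates is a continuous surjective homomorphism, hence uniformly
distributed, and points are null. -/
theorem ae_sub_ne {n : ℕ} {a b : Fin n} (hab : a ≠ b) (c : Circ) :
    ∀ᵐ ω ∂sampleLaw n, ω a - ω b ≠ c := by
  let D : (Fin n → Circ) →+ Circ := Pi.evalAddMonoidHom (fun _ => Circ) a - Pi.evalAddMonoidHom (fun _ => Circ) b
  have hc : Continuous D := (continuous_apply a).sub (continuous_apply b)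
  have hs : Function.Surjective D := by
    intro x
    refine ⟨(Pi.single a x : Fin n → Circ), ?_⟩
    show (Pi.single a x : Fin n → Circ) a - (Pi.single a x : Fin n → Circ) b = x
    rw [Pi.single_eq_same, Pi.single_eq_of_ne hab.symm, sub_zero]
  have hD : MeasurePreserving D (volume : Measure (Fin n → Circ)) volume :=
    AddMonoidHom.measurePreserving hc hs (by simp)
  have h := hD.measure_preimage (s := {c}) (measurableSet_singleton c).nullMeasurableSet
  rw [volume_singleton_circ] at h
  rw [ae_iff]
  simp only [ne_eq, not_not]
  exact h

theorem ae_ne {n : ℕ} (a : Fin n) (c : Circ) : ∀ᵐ ω ∂sampleLaw n, ω a ≠ c := by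
  have h := (measurePreserving_eval (fun _ : Fin n => (volume : Measure Circ)) a).measure_preimage
    (s := {c}) (measurableSet_singleton c).nullMeasurableSet
  rw [volume_singleton_circ] at h
  rw [ae_iff]
  simp only [ne_eq, not_not]
  exact h

theorem ae_injective (n : ℕ) : ∀ᵐ ω ∂sampleLaw n, Function.Injective ω := by
  have h : ∀ᵐ ω ∂sampleLaw n, ∀ a b : Fin n, a ≠ b → ω a - ω b ≠ 0 := by
    rw [ae_all_iff]; intro a
    rw [ae_all_iff]; intro b
    by_cases hab : a = b
    · exact ae_of_all _ fun ω h => absurd hab h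
    · filter_upwards [ae_sub_ne hab 0] with ω hω _ using hω
  filter_upwards [h] with ω hω a b hab
  by_contra hne
  exact hω a b hne (sub_eq_zero.2 hab)

theorem ae_isGeneric (n : ℕ) (r : ℝ) : ∀ᵐ ω ∂sampleLaw n, IsGeneric (Set.range ω) r := by
  have h : ∀ᵐ ω ∂sampleLaw n, ∀ a b : Fin n, a ≠ b → ∀ k : ℤ, ω a - ω b ≠ ((k * r : ℝ) : Circ) := by
    rw [ae_all_iff]; intro a
    rw [ae_all_iff]; intro b
    by_cases hab : a = b
    · exact ae_of_all _ fun ω h => absurd hab h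
    · have : ∀ᵐ ω ∂sampleLaw n, ∀ k : ℤ, ω a - ω b ≠ ((k * r : ℝ) : Circ) :=
        ae_all_iff.2 fun k => ae_sub_ne hab _
      filter_upwards [this] with ω hω _ using hω
  filter_upwards [h] with ω hω
  rintro _ ⟨a, rfl⟩ _ ⟨b, rfl⟩ hne k
  exact hω a b (fun h => hne (by rw [h])) k

/-- The law of the gaps seen from a fixed point. -/
theorem measure_gaps_insert (hq : 0 < q) (hcop : Nat.Coprime p q) (x₀ : Circ) {N : ℕ}
    (hN : 0 < N) :
    sampleLaw N {ω | gaps (i + q - 1) (insert x₀ (Set.range ω)) ((p : ℝ) / q) x₀ ∈ smallCone q i} =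
      N.descFactorial ((i + q - 1) + (i + q - 1)) * ∫⁻ u in smallCone q i,
        ENNReal.ofReal (1 - norm1 u) ^ (N - ((i + q - 1) + (i + q - 1))) := by
  have hgen : ∀ᵐ ω ∂sampleLaw N, ∀ k, ω k ≠ x₀ := ae_all_iff.2 fun k => ae_ne k x₀
  have e : {ω | gaps (i + q - 1) (insert x₀ (Set.range ω)) ((p : ℝ) / q) x₀ ∈ smallCone q i}
      =ᵐ[sampleLaw N] ⋃ σ, tupleEvent p q i x₀ σ := by
    filter_upwards [hgen, ae_injective N] with ω h1 h2
    apply propext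
    have h3 := gaps_mem_smallCone_iff (i := i) hq hcop hN h1 h2
    have h4 : ω ∈ (⋃ σ, tupleEvent p q i x₀ σ) ↔ ∃ σ, ω ∈ tupleEvent p q i x₀ σ := Set.mem_iUnion
    exact h3.trans h4.symm
  rw [measure_congr e, measure_iUnion₀]
  · simp only [measure_tupleEvent hq hcop, tsum_fintype, Finset.sum_const, Finset.card_univ,
      Fintype.card_embedding_eq, Fintype.card_sum, Fintype.card_fin, nsmul_eq_mul]
  -- The event determines the points indexed by the embedding, so two embeddings can share only
  -- samples with repeated points.
  · intro σ σ' hne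
    refine measure_mono_null (fun ω hω => ?_) (ae_iff.1 (ae_injective N))
    intro hinj
    apply hne
    ext τ
    have h1 := eq_backTuple_of_mem_tupleEvent hq hcop hω.1
    have h2 := eq_backTuple_of_mem_tupleEvent hq hcop hω.2
    exact congrArg _ (hinj (congrFun (h1.trans h2.symm) τ))
  · exact fun σ => (measurableSet_tupleEvent x₀ σ).nullMeasurableSet

/-- The law of the gaps seen from a sample point. -/
theorem measure_gaps_mem_smallCone (hq : 0 < q) (hcop : Nat.Coprime p q) {N : ℕ} (hN : 0 < N)
    (k : Fin (N + 1)) :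
    sampleLaw (N + 1) {ω | gaps (i + q - 1) (Set.range ω) ((p : ℝ) / q) (ω k) ∈ smallCone q i} =
      N.descFactorial ((i + q - 1) + (i + q - 1)) * ∫⁻ u in smallCone q i,
        ENNReal.ofReal (1 - norm1 u) ^ (N - ((i + q - 1) + (i + q - 1))) := by
  have hE : MeasurableSet {ω : Fin (N + 1) → Circ |
      gaps (i + q - 1) (Set.range ω) ((p : ℝ) / q) (ω k) ∈ smallCone q i} :=
    measurable_gaps (measurable_eval k) _ _ (measurableSet_smallCone q i)
  have h := (measurePreserving_piFinSuccAbove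
    (fun _ : Fin (N + 1) => (volume : Measure Circ)) k).symm
  rw [sampleLaw, ← h.measure_preimage hE.nullMeasurableSet,
    Measure.prod_apply (h.measurable hE)]
  have e : ∀ x₀ : Circ, Prod.mk x₀ ⁻¹' ((MeasurableEquiv.piFinSuccAbove
      (fun _ : Fin (N + 1) => Circ) k).symm ⁻¹' {ω : Fin (N + 1) → Circ |
      gaps (i + q - 1) (Set.range ω) ((p : ℝ) / q) (ω k) ∈ smallCone q i}) =
      {ω | gaps (i + q - 1) (insert x₀ (Set.range ω)) ((p : ℝ) / q) x₀ ∈ smallCone q i} := by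
    intro x₀
    ext ω
    have e1 : (MeasurableEquiv.piFinSuccAbove (fun _ : Fin (N + 1) => Circ) k).symm (x₀, ω) =
      k.insertNth x₀ ω := rfl
    simp only [Set.mem_preimage, Set.mem_ofPred_eq, e1, Fin.range_insertNth,
      Fin.insertNth_apply_same]
    rfl
  simp only [e]
  have h2 : ∀ x₀ : Circ, Measure.pi (fun _ : Fin N => (volume : Measure Circ))
      {ω | gaps (i + q - 1) (insert x₀ (Set.range ω)) ((p : ℝ) / q) x₀ ∈ smallCone q i} = _ :=
    fun x₀ => measure_gaps_insert hq hcop x₀ hN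
  simp only [h2, lintegral_const, measure_univ, mul_one]

end

/-! ### Asymptotics -/

theorem integrable_exp_neg_abs : Integrable fun x : ℝ => Real.exp (-|x|) := by
  rw [← integrableOn_univ, ← Set.Iic_union_Ioi (a := (0 : ℝ))]
  refine IntegrableOn.union ?_ ?_
  · refine (integrableOn_exp_Iic 0).congr_fun (fun x hx => ?_) measurableSet_Iic
    rw [abs_of_nonpos hx, neg_neg]
  · refine (exp_neg_integrableOn_Ioi 0 one_pos).congr_fun (fun x hx => ?_) measurableSet_Ioi
    simp only
    rw [abs_of_pos hx, neg_one_mul]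

theorem integrable_exp_neg_norm1 (m : ℕ) :
    Integrable fun u : GapSpace m => Real.exp (-norm1 u) := by
  have h : Integrable fun f : Fin m → ℝ => ∏ l, Real.exp (-|f l|) :=
    Integrable.fintype_prod fun _ => integrable_exp_neg_abs
  have h2 := h.mul_prod h
  refine h2.congr (ae_of_all _ fun u => ?_)
  simp only [← Real.exp_sum, ← Real.exp_add, norm1, Finset.sum_neg_distrib]
  congr 1; ring

instance isAddHaarMeasure_gapSpace (m : ℕ) : (volume : Measure (GapSpace m)).IsAddHaarMeasure :=
  Measure.prod.instIsAddHaarMeasure (volume : Measure (Fin m → ℝ)) (volume : Measure (Fin m → ℝ))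

theorem norm1_nonneg {m : ℕ} (u : GapSpace m) : 0 ≤ norm1 u :=
  add_nonneg (Finset.sum_nonneg fun _ _ => abs_nonneg _) (Finset.sum_nonneg fun _ _ => abs_nonneg _)

theorem norm1_smul {m : ℕ} {c : ℝ} (hc : 0 ≤ c) (u : GapSpace m) : norm1 (c • u) = c * norm1 u := by
  simp only [norm1, Prod.smul_fst, Prod.smul_snd, Pi.smul_apply, smul_eq_mul, abs_mul,
    abs_of_nonneg hc, ← Finset.mul_sum, mul_add]

theorem H_smul {m : ℕ} {c : ℝ} (hc : 0 < c) (j k : ℕ) (u : GapSpace m) :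
    H j k (c • u) ↔ H j k u := by
  simp only [H, Prod.smul_fst, Prod.smul_snd, Pi.smul_apply, smul_eq_mul, ← Finset.mul_sum]
  exact mul_le_mul_iff_right₀ hc

theorem smul_mem_S {q i : ℕ} {c : ℝ} (hc : 0 < c) (u : GapSpace (i + q - 1)) :
    c • u ∈ S q i ↔ u ∈ S q i := by
  simp only [S, Set.mem_ofPred_eq, H_smul hc, Prod.smul_fst, Prod.smul_snd, Pi.smul_apply,
    smul_eq_mul, mul_nonneg_iff_of_pos_left hc]

/-- The vectors of the cone `S q i` with positive entries. -/
def posCone (q i : ℕ) : Set (GapSpace (i + q - 1)) :=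
  {u | u ∈ S q i ∧ (∀ l, 0 < u.1 l) ∧ (∀ l, 0 < u.2 l)}

theorem smul_mem_smallCone {q i : ℕ} {c : ℝ} (hc : 0 < c) (u : GapSpace (i + q - 1)) :
    c • u ∈ smallCone q i ↔ u ∈ posCone q i ∧ c * norm1 u < 1 / q := by
  simp only [smallCone, posCone, Set.mem_ofPred_eq, smul_mem_S hc, norm1_smul hc.le, Prod.smul_fst,
    Prod.smul_snd, Pi.smul_apply, smul_eq_mul, mul_pos_iff_of_pos_left hc, and_assoc]

theorem measurableSet_posCone (q i : ℕ) : MeasurableSet (posCone q i) := by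
  have h1 : ∀ l, Measurable fun u : GapSpace (i + q - 1) => 0 < u.1 l := fun l =>
    measurableSet_setOfPred.1 (measurableSet_lt measurable_const
      ((measurable_pi_apply l).comp measurable_fst))
  have h2 : ∀ l, Measurable fun u : GapSpace (i + q - 1) => 0 < u.2 l := fun l =>
    measurableSet_setOfPred.1 (measurableSet_lt measurable_const
      ((measurable_pi_apply l).comp measurable_snd))
  exact measurableSet_setOfPred.2 ((measurableSet_setOfPred.1 (measurableSet_S q i)).and
    ((Measurable.forall h1).and (Measurable.forall h2)))

theorem posCone_ae_eq (q i : ℕ) : posCone q i =ᵐ[volume] S q i := by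
  have h : ∀ᵐ f : Fin (i + q - 1) → ℝ, ∀ l, f l ≠ 0 := by
    rw [ae_all_iff]
    intro l
    rw [ae_iff]
    simp only [ne_eq, not_not]
    exact Measure.pi_hyperplane _ l 0
  have h1 : ∀ᵐ u : GapSpace (i + q - 1), ∀ l, u.1 l ≠ 0 := Measure.quasiMeasurePreserving_fst.ae h
  have h2 : ∀ᵐ u : GapSpace (i + q - 1), ∀ l, u.2 l ≠ 0 := Measure.quasiMeasurePreserving_snd.ae h
  filter_upwards [h1, h2] with u h1 h2
  apply propext
  show u ∈ posCone q i ↔ u ∈ S q i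
  exact ⟨fun h => h.1, fun h => ⟨h, fun l => lt_of_le_of_ne (h.1 l) (h1 l).symm,
    fun l => lt_of_le_of_ne (h.2.1 l) (h2 l).symm⟩⟩

/-- The probability that the gaps lie in the small cone. -/
def smallProb (q i N : ℕ) : ℝ :=
  N.descFactorial ((i + q - 1) + (i + q - 1)) * ∫ u in smallCone q i,
    (1 - norm1 u) ^ (N - ((i + q - 1) + (i + q - 1)))

theorem measureReal_gaps_mem_smallCone {p q i : ℕ} (hq : 0 < q) (hcop : Nat.Coprime p q) {N : ℕ}
    (hN : 0 < N) (k : Fin (N + 1)) :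
    (sampleLaw (N + 1)).real
      {ω | gaps (i + q - 1) (Set.range ω) ((p : ℝ) / q) (ω k) ∈ smallCone q i} =
      smallProb q i N := by
  rw [Measure.real, measure_gaps_mem_smallCone hq hcop hN k, ENNReal.toReal_mul,
    ENNReal.toReal_natCast, smallProb, integral_eq_lintegral_of_nonneg_ae]
  · congr 2
    refine setLIntegral_congr_fun (measurableSet_smallCone q i) fun u hu => ?_
    rw [ENNReal.ofReal_pow]
    have h1 : (1 : ℝ) / q ≤ 1 := by
      rw [div_le_one (by exact_mod_cast hq)]; exact_mod_cast hq
    linarith [hu.2.2.2]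
  · filter_upwards [ae_restrict_mem (measurableSet_smallCone q i)] with u hu
    have h1 : (1 : ℝ) / q ≤ 1 := by
      rw [div_le_one (by exact_mod_cast hq)]; exact_mod_cast hq
    exact pow_nonneg (by linarith [hu.2.2.2]) _
  · exact ((measurable_const.sub (measurable_norm1 _)).pow_const _).aestronglyMeasurable

theorem tendsto_descFactorial_div_pow (d : ℕ) :
    Tendsto (fun N : ℕ => (N.descFactorial d : ℝ) / (N : ℝ) ^ d) atTop (𝓝 1) := by
  have h0 : Tendsto (fun N : ℕ => (1 - (d : ℝ) / N) ^ d) atTop (𝓝 1) := by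
    have := ((tendsto_const_div_atTop_nhds_zero_nat (d : ℝ)).const_sub 1).pow d
    simpa using this
  refine tendsto_of_tendsto_of_tendsto_of_le_of_le' h0 tendsto_const_nhds ?_ ?_
  · filter_upwards [eventually_ge_atTop (d + 1)] with N hN
    have hN0 : (0 : ℝ) < N := by exact_mod_cast (by omega : 0 < N)
    rw [le_div_iff₀ (by positivity), ← mul_pow]
    have h1 : (((N + 1 - d) ^ d : ℕ) : ℝ) ≤ N.descFactorial d := by
      exact_mod_cast Nat.pow_sub_le_descFactorial N d
    refine le_trans ?_ h1
    push_cast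
    rw [Nat.cast_sub (by omega)]
    have h2 : (1 - (d : ℝ) / N) * N = N - d := by field_simp
    rw [h2]
    have : (d : ℝ) + 1 ≤ N := by exact_mod_cast hN
    push_cast
    gcongr
    · linarith
    · linarith
  · filter_upwards [eventually_ge_atTop 1] with N hN
    have hN0 : (0 : ℝ) < N := by exact_mod_cast hN
    rw [div_le_one (by positivity)]
    exact_mod_cast Nat.descFactorial_le_pow N d

theorem tendsto_one_sub_div_pow_sub (x : ℝ) (d : ℕ) :
    Tendsto (fun N : ℕ => (1 - x / N) ^ (N - d)) atTop (𝓝 (Real.exp (-x))) := by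
  have h1 := Real.tendsto_one_add_div_pow_exp (-x)
  have h0 := (tendsto_const_div_atTop_nhds_zero_nat x).const_sub 1
  have h2 := h0.pow d
  have h3 := h1.div h2 (by simp)
  simp only [sub_zero, one_pow, div_one] at h3
  refine h3.congr' ?_
  have hpos : ∀ᶠ N : ℕ in atTop, 0 < 1 - x / (N : ℝ) := by
    rw [sub_zero] at h0
    exact h0.eventually (lt_mem_nhds one_pos)
  filter_upwards [hpos, eventually_ge_atTop d] with N hN hd
  show (1 + -x / (N : ℝ)) ^ N / (1 - x / (N : ℝ)) ^ d = _
  rw [neg_div, ← sub_eq_add_neg, div_eq_iff (pow_ne_zero _ hN.ne'), ← pow_add, Nat.sub_add_cancel hd]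

/-- A majorant uniform in `N`: the `d` missing factors cost at most `exp d`, because `x / N ≤ 1`. -/
theorem one_sub_div_pow_sub_le {x : ℝ} {N d : ℕ} (hN : 0 < N) (hx0 : 0 ≤ x) (hx : x ≤ N) :
    (1 - x / N) ^ (N - d) ≤ Real.exp (d : ℝ) * Real.exp (-x) := by
  have hN0 : (0 : ℝ) < N := by exact_mod_cast hN
  have h1 : x / N ≤ 1 := by rw [div_le_one hN0]; exact hx
  have hc : (N : ℝ) - d ≤ (N - d : ℕ) := by
    rcases le_total d N with h | h
    · rw [Nat.cast_sub h]
    · have : (N : ℝ) ≤ d := by exact_mod_cast h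
      have h2 : (0 : ℝ) ≤ (N - d : ℕ) := by positivity
      linarith
  calc (1 - x / N) ^ (N - d) ≤ Real.exp (-(x / N)) ^ (N - d) :=
        pow_le_pow_left₀ (by linarith) (Real.one_sub_le_exp_neg _) _
    _ = Real.exp ((N - d : ℕ) * (-(x / N))) := (Real.exp_nat_mul _ _).symm
    _ ≤ Real.exp (d + -x) := by
        apply Real.exp_le_exp.2
        have h2 : (0 : ℝ) ≤ x / N := by positivity
        have h3 : ((N : ℝ) - d) * (x / N) ≤ (N - d : ℕ) * (x / N) := by gcongr
        have h4 : ((N : ℝ) - d) * (x / N) = x - d * (x / N) := by field_simp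
        have h5 : (d : ℝ) * (x / N) ≤ d * 1 := by gcongr
        linarith
    _ = _ := Real.exp_add _ _

/-- After the substitution `u = v / N` in dimension `d`, the Jacobian `N^(-d)` balances the falling
factorial. The cone is invariant under scaling, and the cutoff `‖v‖₁ < N / q` disappears in the
limit. -/
theorem tendsto_smallProb {q i : ℕ} (hq : 0 < q) :
    Tendsto (smallProb q i) atTop (𝓝 (∫ u in S q i, Real.exp (-norm1 u))) := by
  set m := i + q - 1 with hm
  set d := m + m with hd
  set F : ℕ → GapSpace m → ℝ := fun N v =>
    (smallCone q i).indicator (fun u => (1 - norm1 u) ^ (N - d)) ((N : ℝ)⁻¹ • v) with hF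
  have hcone : ∀ N : ℕ, 0 < N → ∀ v : GapSpace m,
      (N : ℝ)⁻¹ • v ∈ smallCone q i ↔ v ∈ posCone q i ∧ norm1 v / N < 1 / q := by
    intro N hN v
    have hN0 : (0 : ℝ) < N := by exact_mod_cast hN
    rw [smul_mem_smallCone (inv_pos.2 hN0), inv_mul_eq_div]
  have hFval : ∀ N : ℕ, ∀ v : GapSpace m, norm1 ((N : ℝ)⁻¹ • v) = norm1 v / N := by
    intro N v
    rw [norm1_smul (by positivity), inv_mul_eq_div]
  have hFm : ∀ N, Measurable (F N) := fun N =>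
    (((measurable_const.sub (measurable_norm1 _)).pow_const _).indicator
      (measurableSet_smallCone q i)).comp (measurable_const_smul _)
  have hq1 : (1 : ℝ) / q ≤ 1 := by
    rw [div_le_one (by exact_mod_cast hq)]; exact_mod_cast hq
  have hlim : Tendsto (fun N => ∫ v, F N v) atTop
      (𝓝 (∫ v, (posCone q i).indicator (fun u => Real.exp (-norm1 u)) v)) := by
    refine tendsto_integral_filter_of_dominated_convergence
      (fun u => Real.exp (d : ℝ) * Real.exp (-norm1 u))
      (Eventually.of_forall fun N => (hFm N).aestronglyMeasurable) ?_
      ((integrable_exp_neg_norm1 m).const_mul _) ?_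
    · filter_upwards [eventually_gt_atTop 0] with N hN
      refine ae_of_all _ fun v => ?_
      have hN0 : (0 : ℝ) < N := by exact_mod_cast hN
      simp only [hF]
      by_cases hv : (N : ℝ)⁻¹ • v ∈ smallCone q i
      · rw [Set.indicator_of_mem hv, hFval]
        have h2 := ((hcone N hN v).1 hv).2
        have h3 : norm1 v / N ≤ 1 := by linarith
        rw [Real.norm_of_nonneg (pow_nonneg (by linarith) _)]
        exact one_sub_div_pow_sub_le hN (norm1_nonneg v) ((div_le_one hN0).1 h3)
      · rw [Set.indicator_of_notMem hv, norm_zero]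
        positivity
    · refine ae_of_all _ fun v => ?_
      by_cases hv : v ∈ posCone q i
      · rw [Set.indicator_of_mem hv]
        refine (tendsto_one_sub_div_pow_sub (norm1 v) d).congr' ?_
        have h0 := (tendsto_const_div_atTop_nhds_zero_nat (norm1 v)).eventually
          (gt_mem_nhds (show (0 : ℝ) < 1 / q by positivity))
        filter_upwards [h0, eventually_gt_atTop 0] with N h0 hN
        simp only [hF]
        rw [Set.indicator_of_mem ((hcone N hN v).2 ⟨hv, h0⟩), hFval]
      · rw [Set.indicator_of_notMem hv]
        refine tendsto_const_nhds.congr' ?_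
        filter_upwards [eventually_gt_atTop 0] with N hN
        simp only [hF]
        rw [Set.indicator_of_notMem fun h => hv ((hcone N hN v).1 h).1]
  rw [integral_indicator (measurableSet_posCone q i),
    setIntegral_congr_set (posCone_ae_eq q i)] at hlim
  have hprod := (tendsto_descFactorial_div_pow d).mul hlim
  rw [one_mul] at hprod
  refine hprod.congr' ?_
  filter_upwards [eventually_gt_atTop 0] with N hN
  have hN0 : (0 : ℝ) < N := by exact_mod_cast hN
  have hs := Measure.integral_comp_smul (volume : Measure (GapSpace m))
    ((smallCone q i).indicator (fun u => (1 - norm1 u) ^ (N - d))) ((N : ℝ)⁻¹)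
  have hdim : Module.finrank ℝ (GapSpace m) = d := by simp [hd]
  rw [hdim, integral_indicator (measurableSet_smallCone q i), inv_pow, inv_inv,
    abs_of_pos (by positivity), smul_eq_mul] at hs
  simp only [hF]
  show _ = (N.descFactorial d : ℝ) * ∫ u in smallCone q i, (1 - norm1 u) ^ (N - d)
  rw [hs]
  field_simp

/-! ### Samples are fine -/

/-- A point of `X` in the arc following the one that contains `a` lies strictly after `a`, at
distance less than two arc lengths. -/
theorem isFine_of_arcs {X : Set Circ} {M : ℕ} (hM : 2 ≤ M) {η : ℝ} (hη : 2 / (M : ℝ) ≤ η)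
    (h : ∀ l : Fin M, ∃ t ∈ X, cdist 0 t ∈ Set.Ico ((l : ℝ) / M) ((l + 1) / M)) : IsFine X η := by
  intro a
  have hM0 : (0 : ℝ) < M := by exact_mod_cast (by omega : 0 < M)
  have hM2 : (2 : ℝ) / M ≤ 1 := by rw [div_le_one hM0]; exact_mod_cast hM
  have e2 : (2 : ℝ) / M = 1 / M + 1 / M := by ring
  set c := cdist 0 a with hc
  have hc0 : 0 ≤ c := cdist_nonneg 0 a
  have hc1 : c < 1 := cdist_lt_one 0 a
  have ha : (c : Circ) = a := by rw [hc, coe_cdist, sub_zero]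
  set l := ⌊c * M⌋₊ with hl
  have hl1 : (l : ℝ) ≤ c * M := Nat.floor_le (by positivity)
  have hl2 : c * M < l + 1 := Nat.lt_floor_add_one _
  have hlM : l < M := by
    have : (l : ℝ) < M := by nlinarith
    exact_mod_cast this
  have k1 : (l : ℝ) / M ≤ c := by rw [div_le_iff₀ hM0]; exact hl1
  have k2 : c < (l + 1 : ℝ) / M := by rw [lt_div_iff₀ hM0]; exact hl2
  have key : ∀ t ∈ X, ∀ b : ℝ, ((cdist 0 t : ℝ) : Circ) = (b : Circ) → (l + 1 : ℝ) / M ≤ b →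
      b < (l + 2 : ℝ) / M → ∃ t ∈ X, 0 < cdist a t ∧ cdist a t < η := by
    intro t ht b hb hb1 hb2
    have e3 : (l + 2 : ℝ) / M = l / M + 2 / M := by ring
    have : cdist a t = b - c := by
      refine cdist_eq_of_add (by linarith) (by linarith) ?_
      rw [← ha, ← AddCircle.coe_add, add_sub_cancel, ← hb, coe_cdist, sub_zero]
    exact ⟨t, ht, by linarith, by linarith⟩
  rcases Nat.lt_or_ge (l + 1) M with h1 | h1
  · obtain ⟨t, ht, ht1, ht2⟩ := h ⟨l + 1, h1⟩
    refine key t ht _ rfl ?_ ?_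
    · simpa using ht1
    · have : ((l : ℝ) + 1 + 1) / M = (l + 2) / M := by ring
      simpa [this] using ht2
  -- The arc following the last one is the first, whose points are lifted by one turn.
  · obtain ⟨t, ht, ht1, ht2⟩ := h ⟨0, by omega⟩
    have hMl : (l : ℝ) + 1 = M := by
      have : l + 1 = M := by omega
      exact_mod_cast this
    refine key t ht (cdist 0 t + ((1 : ℤ) : ℝ)) (coe_add_int _ _).symm ?_ ?_
    · rw [hMl, div_self hM0.ne']
      have := cdist_nonneg 0 t
      push_cast; linarith
    · have e : (l + 2 : ℝ) / M = 1 + 1 / M := by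
        have : (l + 2 : ℝ) = M + 1 := by linarith
        rw [this, add_div, div_self hM0.ne']
      rw [e]
      simp only [Nat.cast_zero, zero_add] at ht2
      push_cast; linarith

/-- If fineness fails, one of `M` equal arcs is missed by all `n` points; the union bound `M * (1 -
1 / M)^n` decays geometrically. -/
theorem tendsto_measure_not_isFine {η : ℝ} (hη : 0 < η) :
    Tendsto (fun n => (sampleLaw n).real {ω | ¬ IsFine (Set.range ω) η}) atTop (𝓝 0) := by
  obtain ⟨M, hM⟩ := exists_nat_gt (max 2 (2 / η))
  have hM2 : 2 ≤ M := by
    have : (2 : ℝ) < M := (le_max_left _ _).trans_lt hM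
    exact_mod_cast this.le
  have hM0 : (0 : ℝ) < M := by exact_mod_cast (by omega : 0 < M)
  have hMη : 2 / (M : ℝ) ≤ η := by
    have : 2 / η < M := (le_max_right _ _).trans_lt hM
    rw [div_lt_iff₀ hη] at this
    rw [div_le_iff₀ hM0]; linarith
  have hM1 : (1 : ℝ) / M ≤ 1 := by
    rw [div_le_one hM0]; exact_mod_cast (by omega : 1 ≤ M)
  have harc : ∀ l : Fin M, (volume : Measure Circ).real
      {t | cdist 0 t ∈ Set.Ico ((l : ℝ) / M) ((l + 1) / M)}ᶜ = 1 - 1 / M := by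
    intro l
    have hlM : (l + 1 : ℝ) ≤ M := by exact_mod_cast l.2
    have h := (measurePreserving_cdist 0).measure_preimage
      (s := Set.Ico ((l : ℝ) / M) ((l + 1) / M)) measurableSet_Ico.nullMeasurableSet
    have hsub : Set.Ico ((l : ℝ) / M) ((l + 1) / M) ⊆ Set.Ico 0 1 :=
      Set.Ico_subset_Ico (by positivity) ((div_le_one hM0).2 hlM)
    rw [Measure.restrict_apply measurableSet_Ico, Set.inter_eq_left.2 hsub, Real.volume_Ico] at h
    have hm : MeasurableSet (cdist 0 ⁻¹' Set.Ico ((l : ℝ) / M) ((l + 1) / M)) :=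
      measurable_cdist_zero measurableSet_Ico
    have e : {t | cdist 0 t ∈ Set.Ico ((l : ℝ) / M) ((l + 1) / M)} =
      cdist 0 ⁻¹' Set.Ico ((l : ℝ) / M) ((l + 1) / M) := rfl
    have e1 : ((l : ℝ) + 1) / M - l / M = 1 / M := by ring
    rw [e, probReal_compl_eq_one_sub hm, Measure.real, h, e1, ENNReal.toReal_ofReal (by positivity)]
  have hbound : ∀ n : ℕ, (sampleLaw n).real {ω | ¬ IsFine (Set.range ω) η} ≤
      M * (1 - 1 / (M : ℝ)) ^ n := by
    intro n
    have hsub : {ω : Fin n → Circ | ¬ IsFine (Set.range ω) η} ⊆ ⋃ l : Fin M,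
        Set.univ.pi fun _ => {t | cdist 0 t ∈ Set.Ico ((l : ℝ) / M) ((l + 1) / M)}ᶜ := by
      intro ω hω
      by_contra hn
      apply hω
      refine isFine_of_arcs hM2 hMη fun l => ?_
      by_contra hl
      apply hn
      refine Set.mem_iUnion.2 ⟨l, fun k _ hk => hl ⟨ω k, ⟨k, rfl⟩, hk⟩⟩
    calc _ ≤ _ := measureReal_mono hsub
      _ ≤ ∑ l : Fin M, (sampleLaw n).real (Set.univ.pi fun _ =>
          {t | cdist 0 t ∈ Set.Ico ((l : ℝ) / M) ((l + 1) / M)}ᶜ) := measureReal_iUnion_fintype_le _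
      _ = ∑ l : Fin M, (1 - 1 / (M : ℝ)) ^ n := by
          refine Finset.sum_congr rfl fun l _ => ?_
          rw [Measure.real, sampleLaw, Measure.pi_pi, Finset.prod_const, ENNReal.toReal_pow,
            Finset.card_univ, Fintype.card_fin, ← harc l]
          rfl
      _ = _ := by simp
  refine squeeze_zero (fun n => measureReal_nonneg) hbound ?_
  have h1M : 0 < 1 / (M : ℝ) := by positivity
  have := (tendsto_pow_atTop_nhds_zero_of_lt_one (r := 1 - 1 / (M : ℝ)) (by linarith)
    (by linarith)).const_mul (M : ℝ)
  simpa using this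

/-! ### The limits -/

theorem gaps_lt {X : Set Circ} (hX : X.Finite) {η : ℝ} (h : IsFine X η) (m : ℕ) (r : ℝ)
    (x : Circ) :
    (∀ l, 0 < (gaps m X r x).1 l ∧ (gaps m X r x).1 l < η) ∧
      (∀ l, 0 < (gaps m X r x).2 l ∧ (gaps m X r x).2 l < η) := by
  have key : ∀ a, 0 < cdist a (next X a) ∧ cdist a (next X a) < η := by
    intro a
    have hs := next_spec hX (h.exists_ne a)
    obtain ⟨t, ht, h0, h1⟩ := h a
    exact ⟨cdist_pos_iff.2 hs.2.1, (hs.2.2 t ht (cdist_pos_iff.1 h0)).trans_lt h1⟩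
  constructor
  · rintro ⟨l, hl⟩
    cases l <;> exact key _
  · exact fun l => key _

/-- In a fine set every gap is positive and shorter than `η`, so the extra conditions of the small
cone hold automatically. -/
theorem gaps_mem_S_iff {X : Set Circ} (hX : X.Finite) {η : ℝ} (h : IsFine X η) {q i : ℕ}
    (hη : 2 * (i + q : ℕ) * η < 1 / q) (hη0 : 0 < η) (r : ℝ) (x : Circ) :
    gaps (i + q - 1) X r x ∈ S q i ↔ gaps (i + q - 1) X r x ∈ smallCone q i := by
  have hg := gaps_lt hX h (i + q - 1) r x
  refine ⟨fun hS => ⟨hS, fun l => (hg.1 l).1, fun l => (hg.2 l).1, ?_⟩, fun hS => hS.1⟩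
  set u := gaps (i + q - 1) X r x
  have h1 : ∑ l, |u.1 l| ≤ ∑ _l : Fin (i + q - 1), η := Finset.sum_le_sum fun l _ => by
    rw [abs_of_pos (hg.1 l).1]; exact (hg.1 l).2.le
  have h2 : ∑ l, |u.2 l| ≤ ∑ _l : Fin (i + q - 1), η := Finset.sum_le_sum fun l _ => by
    rw [abs_of_pos (hg.2 l).1]; exact (hg.2 l).2.le
  simp only [Finset.sum_const, Finset.card_univ, Fintype.card_fin, nsmul_eq_mul] at h1 h2
  have h3 : ((i + q - 1 : ℕ) : ℝ) * η ≤ (i + q : ℕ) * η := by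
    have : ((i + q - 1 : ℕ) : ℝ) ≤ (i + q : ℕ) := by exact_mod_cast Nat.sub_le _ _
    gcongr
  rw [norm1]
  linarith

/-- Only monotonicity and subadditivity are used, so the exceptional set `C`, here the samples that
are not fine, needs no measurability. -/
theorem abs_measureReal_sub_le {α : Type*} [MeasurableSpace α] {μ : Measure α} [IsFiniteMeasure μ]
    {A B C : Set α} (h : ∀ᵐ ω ∂μ, ω ∉ C → (ω ∈ A ↔ ω ∈ B)) :
    |μ.real A - μ.real B| ≤ μ.real C := by
  have key : ∀ A B : Set α, (∀ᵐ ω ∂μ, ω ∉ C → (ω ∈ A ↔ ω ∈ B)) →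
      μ.real A ≤ μ.real B + μ.real C := by
    intro A B h
    have h1 : μ A ≤ μ (B ∪ C) := measure_mono_ae (by
      filter_upwards [h] with ω hω hA
      by_cases hC : ω ∈ C
      · exact Or.inr hC
      · exact Or.inl ((hω hC).1 hA))
    calc μ.real A ≤ μ.real (B ∪ C) := ENNReal.toReal_mono (measure_ne_top _ _) h1
      _ ≤ _ := measureReal_union_le _ _
  have h1 := key A B h
  have h2 := key B A (by filter_upwards [h] with ω hω hC using (hω hC).symm)
  rw [abs_le]
  constructor <;> linarith

section

variable {p q i : ℕ} {η : ℝ}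

theorem abs_prob_gaps_sub_le (hp : 0 < p) (hpq : p ≤ q) (hcop : Nat.Coprime p q) (hη0 : 0 < η)
    (hη : 2 * (i + q : ℕ) * η < 1 / q) {N : ℕ} (hN : 0 < N) (k : Fin (N + 1)) :
    |(sampleLaw (N + 1)).real
        {ω | gaps (i + q - 1) (Set.range ω) ((p : ℝ) / q) (ω k) ∈ S q i} - smallProb q i N| ≤
      (sampleLaw (N + 1)).real {ω | ¬ IsFine (Set.range ω) η} := by
  have hq := hp.trans_le hpq
  rw [← measureReal_gaps_mem_smallCone hq hcop hN k]
  exact abs_measureReal_sub_le (ae_of_all _ fun ω hω =>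
    gaps_mem_S_iff (Set.finite_range ω) (not_not.1 hω) hη hη0 _ _)

theorem abs_prob_isOfType_sub_le (hp : 0 < p) (hpq : p ≤ q) (hcop : Nat.Coprime p q) (hη0 : 0 < η)
    (hη : 2 * (i + q : ℕ) * η < 1 / q) (hη' : (q + 2 * i + 2) * η < 1) {N : ℕ} (hN : 0 < N)
    (k : Fin (N + 1)) :
    |(sampleLaw (N + 1)).real
        {ω | IsOfType (Set.range ω) p q i (ω k) ∧ ∀ j < k, ω j ≠ ω k} - smallProb q i N| ≤
      (sampleLaw (N + 1)).real {ω | ¬ IsFine (Set.range ω) η} := by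
  have hq := hp.trans_le hpq
  rw [← measureReal_gaps_mem_smallCone hq hcop hN k]
  refine abs_measureReal_sub_le ?_
  filter_upwards [ae_isGeneric (N + 1) ((p : ℝ) / q), ae_injective (N + 1)] with ω h1 h2 hω
  have hfin := Set.finite_range ω
  have hfine : IsFine (Set.range ω) η := not_not.1 hω
  have h3 := isOfType_iff hfin hfine hp hpq hcop hη0 hη' h1 ⟨k, rfl⟩
  have h4 := gaps_mem_S_iff hfin hfine hη hη0 ((p : ℝ) / q) (ω k)
  exact ⟨fun h => h4.1 (h3.1 h.1), fun h => ⟨h3.2 (h4.2 h), fun j hj e => hj.ne (h2 e)⟩⟩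

theorem integral_swi (hp : 0 < p) (hpq : p ≤ q) (n : ℕ) :
    ∫ ω : Fin n → Circ, (swi (Set.range ω) p q i : ℝ) ∂sampleLaw n =
      ∑ k : Fin n, (sampleLaw n).real
        {ω | IsOfType (Set.range ω) p q i (ω k) ∧ ∀ j < k, ω j ≠ ω k} := by
  classical
  have hm : ∀ k : Fin n, MeasurableSet {ω : Fin n → Circ |
      IsOfType (Set.range ω) p q i (ω k) ∧ ∀ j < k, ω j ≠ ω k} := fun k =>
    measurableSet_setOfPred.2 ((measurable_isOfType (measurable_eval k) (fun ω => ⟨k, rfl⟩)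
      hp hpq i).and (Measurable.forall fun j => measurable_const.imp (measurableSet_setOfPred.1
        (measurableSet_eq_fun (measurable_eval j) (measurable_eval k))).not))
  have e : ∀ ω : Fin n → Circ, (swi (Set.range ω) p q i : ℝ) = ∑ k : Fin n,
      Set.indicator {ω : Fin n → Circ | IsOfType (Set.range ω) p q i (ω k) ∧ ∀ j < k, ω j ≠ ω k}
        (1 : (Fin n → Circ) → ℝ) ω := by
    intro ω
    rw [swi_eq_sum]
    push_cast
    exact Finset.sum_congr rfl fun k _ => by simp only [Set.indicator_apply]; rfl
  simp only [e]
  rw [integral_finsetSum]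
  swap
  · exact fun k _ => (integrable_const (1 : ℝ)).indicator (hm k)
  exact Finset.sum_congr rfl fun k _ => integral_indicator_one (hm k)

theorem exists_fineness (q i : ℕ) (hq : 0 < q) :
    ∃ η : ℝ, 0 < η ∧ 2 * (i + q : ℕ) * η < 1 / q ∧ (q + 2 * i + 2) * η < 1 := by
  have hq' : (1 : ℝ) ≤ q := by exact_mod_cast hq
  have hi : (0 : ℝ) ≤ i := by positivity
  have hD : (0 : ℝ) < q * (2 * i + 2 * q + 3) := by positivity
  -- The second factor exceeds both `2 * (i + q)` and `q + 2 * i + 2`; the factor `q` provides the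
  -- bound `1 / q`.
  refine ⟨1 / (q * (2 * i + 2 * q + 3)), by positivity, ?_, ?_⟩
  · push_cast
    rw [mul_one_div, div_lt_div_iff₀ hD (by positivity)]
    nlinarith
  · rw [mul_one_div, div_lt_one hD]
    nlinarith

end

end CyclicDyn

end

theorem proposition3p4 (p q i : ℕ) (hp : 0 < p) (hpq : p ≤ q) (hcop : Nat.Coprime p q) :
    (∀ n : ℕ, Integrable (fun ω : Fin n → CyclicDyn.Circ =>
        (CyclicDyn.swi (Set.range ω) p q i : ℝ)) (CyclicDyn.sampleLaw n)) ∧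
    (∀ (n : ℕ) (k : Fin n), NullMeasurableSet
        {ω : Fin n → CyclicDyn.Circ |
          CyclicDyn.gaps (i + q - 1) (Set.range ω) ((p : ℝ) / q) (ω k) ∈ CyclicDyn.S q i}
        (CyclicDyn.sampleLaw n)) ∧
    IntegrableOn (fun u => Real.exp (-CyclicDyn.norm1 u)) (CyclicDyn.S q i) ∧
    Tendsto (fun n : ℕ => (∫ ω : Fin n → CyclicDyn.Circ,
        (CyclicDyn.swi (Set.range ω) p q i : ℝ) ∂CyclicDyn.sampleLaw n) / n) atTop
      (𝓝 (∫ u in CyclicDyn.S q i, Real.exp (-CyclicDyn.norm1 u))) ∧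
    (∀ k : (n : ℕ) → Fin (n + 1), Tendsto (fun n : ℕ => (CyclicDyn.sampleLaw (n + 1)).real
        {ω : Fin (n + 1) → CyclicDyn.Circ |
          CyclicDyn.gaps (i + q - 1) (Set.range ω) ((p : ℝ) / q) (ω (k n)) ∈ CyclicDyn.S q i})
      atTop (𝓝 (∫ u in CyclicDyn.S q i, Real.exp (-CyclicDyn.norm1 u)))) := by
  have hq := hp.trans_le hpq
  obtain ⟨η, hη0, hη, hη'⟩ := CyclicDyn.exists_fineness q i hq
  have hbad := (tendsto_add_atTop_iff_nat 1).2 (CyclicDyn.tendsto_measure_not_isFine hη0)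
  have hlim := CyclicDyn.tendsto_smallProb (i := i) hq
  have of_close : ∀ a : ℕ → ℝ, (∀ N, 0 < N → |a N - CyclicDyn.smallProb q i N| ≤
      (CyclicDyn.sampleLaw (N + 1)).real {ω | ¬ CyclicDyn.IsFine (Set.range ω) η}) →
      Tendsto a atTop (𝓝 (∫ u in CyclicDyn.S q i, Real.exp (-CyclicDyn.norm1 u))) := by
    intro a ha
    have h0 : Tendsto (fun N => a N - CyclicDyn.smallProb q i N) atTop (𝓝 0) :=
      squeeze_zero_norm' (by filter_upwards [eventually_gt_atTop 0] with N hN using ha N hN) hbad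
    simpa using h0.add hlim
  refine ⟨fun n => CyclicDyn.integrable_swi hp hpq i, fun n k =>
    (CyclicDyn.measurableSet_gaps_mem (CyclicDyn.measurable_eval k) _ q i).nullMeasurableSet,
    (CyclicDyn.integrable_exp_neg_norm1 _).integrableOn, ?_, fun k => of_close _ fun N hN =>
      CyclicDyn.abs_prob_gaps_sub_le hp hpq hcop hη0 hη hN (k N)⟩
  -- A sample of `N + 1` points consists of a base point and `N` others. The mean over the `N + 1`
  -- indices inherits the error bound common to all of them.
  refine (tendsto_add_atTop_iff_nat 1).1 (of_close _ fun N hN => ?_)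
  have hN1 : (0 : ℝ) < ((N + 1 : ℕ) : ℝ) := by positivity
  have hsum : CyclicDyn.smallProb q i N = (∑ _k : Fin (N + 1), CyclicDyn.smallProb q i N) / ((N + 1 : ℕ) : ℝ) := by
    rw [Finset.sum_const, Finset.card_univ, Fintype.card_fin, nsmul_eq_mul,
      mul_div_cancel_left₀ _ hN1.ne']
  rw [CyclicDyn.integral_swi hp hpq]
  rw [hsum]
  rw [← sub_div, ← Finset.sum_sub_distrib, abs_div, abs_of_pos hN1, div_le_iff₀ hN1]
  calc _ ≤ _ := Finset.abs_sum_le_sum_abs _ _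
    _ ≤ ∑ _k : Fin (N + 1), (CyclicDyn.sampleLaw (N + 1)).real {ω | ¬ CyclicDyn.IsFine (Set.range ω) η} :=
        Finset.sum_le_sum fun k _ => CyclicDyn.abs_prob_isOfType_sub_le hp hpq hcop hη0 hη hη' hN k
    _ = _ := by
        rw [Finset.sum_const, Finset.card_univ, Fintype.card_fin, nsmul_eq_mul, mul_comm]
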